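/- Let $n\ge 2$. There is a function $C:\mathbb{R}^5\to(0,\infty)$, depending only on $n$ and nondecreasing in each argument, with the following property. Let $\Omega\subset\mathbb{R}^n$ be a bounded convex domain with smooth boundary, and let $\Gamma\subset\Omega$ be either a single point or a (closed, non-degenerate) straight line segment. Let $f\in C^{1,1}(\overline\Omega)$ with $f>0$ in $\overline\Omega$, and let $u$ be a convex function on $\overline\Omega$ with $u\in C^2(\overline\Omega\setminus\Gamma)\cap C^4(\Omega\setminus\Gamma)$ such that $$\det\nabla^2u=f\quad\text{in }\Omega\setminus\Gamma .$$ Then the quantities $\|\nabla\log f\|_{L^\infty(\Omega)}$, $\|\nabla^2\log f\|_{L^\infty(\Omega)}$, $\|\nabla u\|_{L^\infty(\Omega)}$ and $\|\nabla^2u\|_{L^\infty(\partial\Omega)}$ are finite, and for every $x\in\Omega\setminus\Gamma$ $$|\nabla^2u(x)|\le\frac{C}{\operatorname{dist}(x,\Gamma)},$$ where $C=C\big(\operatorname{diam}\Omega,\ \|\nabla\log f\|_{L^\infty(\Omega)},\ \|\nabla^2\log f\|_{L^\infty(\Omega)},\ \|\nabla u\|_{L^\infty(\Omega)},\ \|\nabla^2u\|_{L^\infty(\partial\Omega)}\big)$.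 In particular $C$ depends only on $n$ and these five quantities, and not on $x$. Here $|\nabla^2u|$ is the operator norm. -/

import Mathlib

open MeasureTheory
open scoped Gradient ContDiff NNReal

/-- `Ω` has smooth boundary: near each boundary point, `Ω` is the sublevel set of a smooth
function whose differential does not vanish at that point. -/
def HasSmoothBoundary {n : ℕ} (Ω : Set (EuclideanSpace ℝ (Fin n))) : Prop :=
  ∀ p ∈ frontier Ω, ∃ (U : Set (EuclideanSpace ℝ (Fin n))) (ρ : EuclideanSpace ℝ (Fin n) → ℝ),
    IsOpen U ∧ p ∈ U ∧ ContDiffOn ℝ ∞ ρ U ∧ fderiv ℝ ρ p ≠ 0 ∧ Ω ∩ U = {x ∈ U | ρ x < 0}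

/-- `f` is of class `C^{1,1}` on the closed set `s` (used for the closure of a convex domain):
it is `C¹` up to the boundary and its differential is Lipschitz. -/
def IsC11On {n : ℕ} (f : EuclideanSpace ℝ (Fin n) → ℝ) (s : Set (EuclideanSpace ℝ (Fin n))) :
    Prop :=
  ContDiffOn ℝ 1 f s ∧ ∃ K : ℝ≥0, LipschitzOnWith K (fderivWithin ℝ f s) s

/-- The Hessian matrix `(∂ᵢ∂ⱼ u(x))`. -/
noncomputable def hessianMatrix {n : ℕ} (u : EuclideanSpace ℝ (Fin n) → ℝ)
    (x : EuclideanSpace ℝ (Fin n)) : Matrix (Fin n) (Fin n) ℝ :=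
  Matrix.of fun i j =>
    iteratedFDeriv ℝ 2 u x ![EuclideanSpace.single i 1, EuclideanSpace.single j 1]

/-- `‖∇v‖_{L^∞(Ω)}`. -/
noncomputable def gradSupNorm {n : ℕ} (v : EuclideanSpace ℝ (Fin n) → ℝ)
    (Ω : Set (EuclideanSpace ℝ (Fin n))) : ENNReal :=
  eLpNorm (fun x => ∇ v x) ⊤ (volume.restrict Ω)

/-- `‖∇²v‖_{L^∞(Ω)}`, with the operator norm of the second derivative. -/
noncomputable def hessSupNorm {n : ℕ} (v : EuclideanSpace ℝ (Fin n) → ℝ)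
    (Ω : Set (EuclideanSpace ℝ (Fin n))) : ENNReal :=
  eLpNorm (fun x => iteratedFDeriv ℝ 2 v x) ⊤ (volume.restrict Ω)

/-- `‖∇²v‖_{L^∞(∂Ω)}` for `v` that is `C²` up to `∂Ω`: the supremum over `∂Ω` of the norm of the
second derivative taken from within the closure of `Ω`. -/
noncomputable def hessBoundarySupNorm {n : ℕ} (v : EuclideanSpace ℝ (Fin n) → ℝ)
    (Ω : Set (EuclideanSpace ℝ (Fin n))) : ENNReal :=
  ⨆ x ∈ frontier Ω, ‖iteratedFDerivWithin ℝ 2 v (closure Ω) x‖ₑ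

/-!
Pogorelov's interior estimate, with an affine cut-off. Separate `x` from `Γ` by a hyperplane and let
`ℓ` be the affine function measuring the distance to it, positive on the side of `x`. On the part
of `closure Ω` where `ℓ ≥ 0` the function `ℓ * |∇²u| * exp (|∇u|² / 2)` attains its maximum. At an
interior maximum point, work in an eigenbasis of `∇²u` with `o` the direction of the largest
eigenvalue: the first and second order conditions for `log ℓ + log ∂ₒ∂ₒu + |∇u|² / 2`, combined with
the equation `log det ∇²u = log f` differentiated once and twice, give a quadratic inequality which
bounds `ℓ * ∂ₒ∂ₒu`. At a boundary point of `Ω` the bound on `∇²u` is part of the data. Letting the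
hyperplane approach `Γ` turns `ℓ x` into `dist(x, Γ)`.
-/

open Filter Topology

theorem deriv_deriv_nonpos_of_isLocalMax {φ : ℝ → ℝ} {a : ℝ} (hmax : IsLocalMax φ a)
    (hφ : ContinuousAt φ a) : deriv (deriv φ) a ≤ 0 := by
  by_contra! hpos
  have hmin : IsLocalMin φ a := isLocalMin_of_deriv_deriv_pos hpos hmax.deriv_eq_zero hφ
  have hconst : φ =ᶠ[𝓝 a] fun _ ↦ φ a := by
    filter_upwards [hmax, hmin] with t ht ht' using le_antisymm ht ht'
  rw [hconst.deriv.deriv_eq] at hpos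
  simp at hpos

/-- The derivative `∂_v g` of `g` in the direction `v`. -/
noncomputable def dirDeriv {E : Type*} [NormedAddCommGroup E] [NormedSpace ℝ E] (v : E)
    (g : E → ℝ) : E → ℝ := fun x ↦ fderiv ℝ g x v

local notation:max "∂[" v "]" => dirDeriv v

section DirectionalDerivative

variable {E : Type*} [NormedAddCommGroup E] [NormedSpace ℝ E]
variable {g : E → ℝ} {x : E}

theorem contDiffAt_dirDeriv {k m : ℕ∞ω} (hg : ContDiffAt ℝ m g x) (hk : k + 1 ≤ m) (v : E) :
    ContDiffAt ℝ k (∂[v] g) x :=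
  (hg.fderiv_right hk).clm_apply contDiffAt_const

theorem contDiffAt_dirDeriv_dirDeriv {k m : ℕ∞ω} (hg : ContDiffAt ℝ m g x) (hk : k + 1 + 1 ≤ m)
    (v w : E) : ContDiffAt ℝ k (∂[v] (∂[w] g)) x :=
  contDiffAt_dirDeriv (contDiffAt_dirDeriv hg hk w) le_rfl v

theorem dirDeriv_eventuallyEq {g₁ g₂ : E → ℝ} (h : g₁ =ᶠ[𝓝 x] g₂) (v : E) :
    ∂[v] g₁ =ᶠ[𝓝 x] ∂[v] g₂ :=
  h.fderiv.fun_comp fun L : E →L[ℝ] ℝ ↦ L v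

theorem dirDeriv_dirDeriv_apply (hg : ContDiffAt ℝ 2 g x) (v w : E) :
    ∂[v] (∂[w] g) x = fderiv ℝ (fderiv ℝ g) x v w := by
  have h : DifferentiableAt ℝ (fderiv ℝ g) x :=
    (hg.fderiv_right (m := 1) (by norm_num)).differentiableAt (by norm_num)
  change fderiv ℝ (fun y ↦ fderiv ℝ g y w) x v = _
  simp [fderiv_clm_apply h (differentiableAt_const w)]

theorem dirDeriv_comm (hg : ContDiffAt ℝ 2 g x) (v w : E) :
    ∂[v] (∂[w] g) =ᶠ[𝓝 x] ∂[w] (∂[v] g) := by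
  filter_upwards [hg.eventually (by decide)] with y hy
  rw [dirDeriv_dirDeriv_apply hy, dirDeriv_dirDeriv_apply hy]
  exact (hy.isSymmSndFDerivAt (by simp)).eq v w

theorem dirDeriv_comm₃ (hg : ContDiffAt ℝ 3 g x) (v w z : E) :
    ∂[v] (∂[w] (∂[z] g)) =ᶠ[𝓝 x] ∂[z] (∂[v] (∂[w] g)) :=
  (dirDeriv_eventuallyEq (dirDeriv_comm (hg.of_le (by norm_num)) w z) v).trans
    (dirDeriv_comm (contDiffAt_dirDeriv hg (by norm_num) w) v z)

theorem dirDeriv_comm₄ (hg : ContDiffAt ℝ 4 g x) (v w : E) :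
    ∂[v] (∂[v] (∂[w] (∂[w] g))) =ᶠ[𝓝 x] ∂[w] (∂[w] (∂[v] (∂[v] g))) :=
  have hg₃ : ContDiffAt ℝ 3 (∂[w] g) x := contDiffAt_dirDeriv hg (by norm_num) w
  have hg' : ContDiffAt ℝ 3 g x := hg.of_le (by norm_num)
  calc ∂[v] (∂[v] (∂[w] (∂[w] g)))
    _ =ᶠ[𝓝 x] ∂[v] (∂[w] (∂[v] (∂[w] g))) :=
      dirDeriv_eventuallyEq (dirDeriv_comm₃ hg' v w w) v
    _ =ᶠ[𝓝 x] ∂[w] (∂[v] (∂[v] (∂[w] g))) :=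
      dirDeriv_comm (contDiffAt_dirDeriv hg₃ (by norm_num) v) v w
    _ =ᶠ[𝓝 x] ∂[w] (∂[w] (∂[v] (∂[v] g))) :=
      dirDeriv_eventuallyEq (dirDeriv_comm₃ hg' v v w) w

theorem tendsto_line (x v : E) : Tendsto (fun t : ℝ ↦ x + t • v) (𝓝 0) (𝓝 x) :=
  Continuous.tendsto' (by fun_prop) 0 x (by simp)

theorem eventually_hasDerivAt_line (hg : ContDiffAt ℝ 1 g x) (v : E) :
    ∀ᶠ t : ℝ in 𝓝 0, HasDerivAt (fun s : ℝ ↦ g (x + s • v)) (∂[v] g (x + t • v)) t := by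
  filter_upwards [(tendsto_line x v).eventually (hg.eventually (by decide))] with t ht
  have hline : HasDerivAt (fun s : ℝ ↦ x + s • v) v t := by
    simpa using ((hasDerivAt_id t).smul_const v).const_add x
  exact (ht.differentiableAt one_ne_zero).hasFDerivAt.comp_hasDerivAt t hline

theorem hasDerivAt_line (hg : ContDiffAt ℝ 1 g x) (v : E) :
    HasDerivAt (fun t : ℝ ↦ g (x + t • v)) (∂[v] g x) 0 := by
  simpa using (eventually_hasDerivAt_line hg v).self_of_nhds

theorem dirDeriv_dirDeriv_nonpos_of_isLocalMax (hmax : IsLocalMax g x) (hg : ContDiffAt ℝ 2 g x)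
    (v : E) : ∂[v] (∂[v] g) x ≤ 0 := by
  have hg₁ : ContDiffAt ℝ 1 g x := hg.of_le (by norm_num)
  have hderiv : deriv (fun t : ℝ ↦ g (x + t • v)) =ᶠ[𝓝 0] fun t ↦ ∂[v] g (x + t • v) :=
    (eventually_hasDerivAt_line hg₁ v).mono fun _ ht ↦ ht.deriv
  rw [← (hasDerivAt_line (contDiffAt_dirDeriv hg (by norm_num) v) v).deriv, ← hderiv.deriv_eq]
  have hmax' : IsLocalMax (fun t : ℝ ↦ g (x + t • v)) 0 :=
    IsLocalMax.comp_continuous (f := g) (g := fun t : ℝ ↦ x + t • v) (by simpa using hmax)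
      (by fun_prop)
  exact deriv_deriv_nonpos_of_isLocalMax hmax' (hasDerivAt_line hg₁ v).continuousAt

theorem dirDeriv_log (hg : DifferentiableAt ℝ g x) (hx : g x ≠ 0) (v : E) :
    ∂[v] (fun y ↦ Real.log (g y)) x = ∂[v] g x / g x := by
  simp [dirDeriv, fderiv.log hg hx, div_eq_inv_mul]

theorem dirDeriv_dirDeriv_log (hg : ContDiffAt ℝ 2 g x) (hx : g x ≠ 0) (v : E) :
    ∂[v] (∂[v] fun y ↦ Real.log (g y)) x = ∂[v] (∂[v] g) x / g x - (∂[v] g x / g x) ^ 2 := by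
  have hg₁ : ContDiffAt ℝ 1 g x := hg.of_le (by norm_num)
  have hfirst : (∂[v] fun y ↦ Real.log (g y)) =ᶠ[𝓝 x] fun y ↦ ∂[v] g y / g y := by
    filter_upwards [hg₁.eventually (by decide), hg.continuousAt.eventually_ne hx] with y hy hy₀
    exact dirDeriv_log (hy.differentiableAt one_ne_zero) hy₀ v
  have hquot : HasDerivAt (fun t : ℝ ↦ ∂[v] g (x + t • v) / g (x + t • v)) _ 0 :=
    (hasDerivAt_line (contDiffAt_dirDeriv hg (by norm_num) v) v).fun_div (hasDerivAt_line hg₁ v)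
      (by simpa using hx)
  have hdiv : ContDiffAt ℝ 1 (fun y ↦ ∂[v] g y / g y) x :=
    (contDiffAt_dirDeriv hg (by norm_num) v).fun_div hg₁ hx
  rw [(dirDeriv_eventuallyEq hfirst v).self_of_nhds,
    (hasDerivAt_line hdiv v).unique hquot]
  simp only [zero_smul, add_zero]
  field_simp

theorem dirDeriv_add {g₁ g₂ : E → ℝ} (h₁ : DifferentiableAt ℝ g₁ x) (h₂ : DifferentiableAt ℝ g₂ x)
    (v : E) : ∂[v] (fun y ↦ g₁ y + g₂ y) x = ∂[v] g₁ x + ∂[v] g₂ x := by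
  simp [dirDeriv, fderiv_fun_add h₁ h₂]

theorem dirDeriv_dirDeriv_add {g₁ g₂ : E → ℝ} (h₁ : ContDiffAt ℝ 2 g₁ x) (h₂ : ContDiffAt ℝ 2 g₂ x)
    (v : E) :
    ∂[v] (∂[v] fun y ↦ g₁ y + g₂ y) x = ∂[v] (∂[v] g₁) x + ∂[v] (∂[v] g₂) x := by
  have h₁' : ContDiffAt ℝ 1 g₁ x := h₁.of_le (by norm_num)
  have h₂' : ContDiffAt ℝ 1 g₂ x := h₂.of_le (by norm_num)
  have hfirst : (∂[v] fun y ↦ g₁ y + g₂ y) =ᶠ[𝓝 x] fun y ↦ ∂[v] g₁ y + ∂[v] g₂ y := by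
    filter_upwards [h₁'.eventually (by decide), h₂'.eventually (by decide)] with y hy₁ hy₂
    exact dirDeriv_add (hy₁.differentiableAt one_ne_zero) (hy₂.differentiableAt one_ne_zero) v
  rw [(dirDeriv_eventuallyEq hfirst v).self_of_nhds]
  exact dirDeriv_add
    ((contDiffAt_dirDeriv (k := 1) h₁ (by norm_num) v).differentiableAt one_ne_zero)
    ((contDiffAt_dirDeriv (k := 1) h₂ (by norm_num) v).differentiableAt one_ne_zero) v

theorem dirDeriv_half_sum_sq {ι : Type*} [Fintype ι] {P : ι → E → ℝ}
    (hP : ∀ k, DifferentiableAt ℝ (P k) x) (v : E) :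
    ∂[v] (fun y ↦ (∑ k, P k y ^ 2) / 2) x = ∑ k, P k x * ∂[v] (P k) x := by
  simp only [div_eq_inv_mul]
  have hsq : HasFDerivAt (fun y ↦ 2⁻¹ * ∑ k, P k y ^ 2) _ x :=
    (HasFDerivAt.fun_sum fun k (_ : k ∈ Finset.univ) ↦ (hP k).hasFDerivAt.pow 2).const_mul 2⁻¹
  rw [dirDeriv, hsq.fderiv]
  simp [dirDeriv, Finset.mul_sum, mul_assoc]

theorem dirDeriv_dirDeriv_half_sum_sq {ι : Type*} [Fintype ι] {P : ι → E → ℝ}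
    (hP : ∀ k, ContDiffAt ℝ 2 (P k) x) (v : E) :
    ∂[v] (∂[v] fun y ↦ (∑ k, P k y ^ 2) / 2) x
      = ∑ k, (∂[v] (P k) x ^ 2 + P k x * ∂[v] (∂[v] (P k)) x) := by
  have hP₁ : ∀ k, ContDiffAt ℝ 1 (P k) x := fun k ↦ (hP k).of_le (by norm_num)
  have hP₂ : ∀ k, ContDiffAt ℝ 1 (∂[v] (P k)) x := fun k ↦
    contDiffAt_dirDeriv (hP k) (by norm_num) v
  have hfirst : (∂[v] fun y ↦ (∑ k, P k y ^ 2) / 2) =ᶠ[𝓝 x] fun y ↦ ∑ k, P k y * ∂[v] (P k) y := by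
    filter_upwards [eventually_all.2 fun k ↦ (hP₁ k).eventually (by decide)] with y hy
    exact dirDeriv_half_sum_sq (fun k ↦ (hy k).differentiableAt one_ne_zero) v
  rw [(dirDeriv_eventuallyEq hfirst v).self_of_nhds]
  have hsum : HasFDerivAt (fun y ↦ ∑ k, P k y * ∂[v] (P k) y) _ x :=
    HasFDerivAt.fun_sum fun k (_ : k ∈ Finset.univ) ↦
      ((hP₁ k).differentiableAt one_ne_zero).hasFDerivAt.fun_mul
        ((hP₂ k).differentiableAt one_ne_zero).hasFDerivAt
  rw [dirDeriv, hsum.fderiv, sum_apply]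
  refine Finset.sum_congr rfl fun k _ ↦ ?_
  simp [dirDeriv]
  ring

end DirectionalDerivative

section LogDet

theorem trace_mul_eq_sum_sum {ι : Type*} [Fintype ι] (A B : Matrix ι ι ℝ) :
    (A * B).trace = ∑ i, ∑ j, A i j * B j i := by
  simp [Matrix.trace, Matrix.mul_apply]

variable {ι : Type*} [Fintype ι] [DecidableEq ι]
variable {M M' : ℝ → Matrix ι ι ℝ} {M'' : Matrix ι ι ℝ} {a : ℝ}

theorem hasDerivAt_det {M' : Matrix ι ι ℝ} (hM : ∀ i j, HasDerivAt (fun t ↦ M t i j) (M' i j) a) :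
    HasDerivAt (fun t ↦ (M t).det) ((M a).adjugate * M').trace a := by
  have hexpand : HasDerivAt (fun t ↦ (M t).det) (∑ σ : Equiv.Perm ι, ((Equiv.Perm.sign σ : ℤ) : ℝ) *
      ∑ i, (∏ j ∈ Finset.univ.erase i, M a (σ j) j) • M' (σ i) i) a := by
    simp only [Matrix.det_apply']
    exact HasDerivAt.fun_sum fun σ _ ↦
      (HasDerivAt.fun_finsetProd fun i _ ↦ hM (σ i) i).const_mul _
  have hcramer : ∀ i, ((M a).adjugate * M') i i = ((M a).updateCol i (M'.col i)).det := fun i ↦ by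
    rw [← Matrix.cramer_apply, Matrix.cramer_eq_adjugate_mulVec]
    rfl
  refine hexpand.congr_deriv ?_
  simp only [Matrix.trace, Matrix.diag_apply, hcramer, Matrix.det_apply', Finset.mul_sum]
  rw [Finset.sum_comm]
  refine Finset.sum_congr rfl fun i _ ↦ Finset.sum_congr rfl fun σ _ ↦ ?_
  have hprod : ∏ j, (M a).updateCol i (M'.col i) (σ j) j
      = M' (σ i) i * ∏ j ∈ Finset.univ.erase i, M a (σ j) j := by
    rw [← Finset.mul_prod_erase _ _ (Finset.mem_univ i), Matrix.updateCol_self]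
    congr 1
    exact Finset.prod_congr rfl fun j hj ↦ Matrix.updateCol_ne (Finset.ne_of_mem_erase hj)
  rw [hprod, smul_eq_mul, mul_comm (M' _ _)]

theorem hasDerivAt_log_det {M' : Matrix ι ι ℝ}
    (hM : ∀ i j, HasDerivAt (fun t ↦ M t i j) (M' i j) a) (hdet : (M a).det ≠ 0) :
    HasDerivAt (fun t ↦ Real.log (M t).det) ((M a)⁻¹ * M').trace a := by
  refine ((hasDerivAt_det hM).log hdet).congr_deriv ?_
  rw [Matrix.inv_def, Ring.inverse_eq_inv', Matrix.smul_mul, Matrix.trace_smul, smul_eq_mul,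
    div_eq_inv_mul]

theorem hasDerivAt_inv_apply {M' : Matrix ι ι ℝ}
    (hM : ∀ i j, HasDerivAt (fun t ↦ M t i j) (M' i j) a) (hdet : (M a).det ≠ 0) (i j : ι) :
    HasDerivAt (fun t ↦ (M t)⁻¹ i j) (-((M a)⁻¹ * M' * (M a)⁻¹) i j) a := by
  open scoped Matrix.Norms.Operator in
  have hunit : IsUnit (M a) := (Matrix.isUnit_iff_isUnit_det _).2 (isUnit_iff_ne_zero.2 hdet)
  have hcurve : HasDerivAt M M' a := hasDerivAt_pi.2 fun i ↦ hasDerivAt_pi.2 fun j ↦ hM i j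
  have hinv := (hasFDerivAt_ringInverse (𝕜 := ℝ) hunit.unit).comp_hasDerivAt_of_eq a hcurve rfl
  rw [Matrix.coe_units_inv, IsUnit.unit_spec] at hinv
  have hentry := hasDerivAt_pi.1 (hasDerivAt_pi.1 hinv i) j
  simp only [Function.comp_apply, ← Matrix.nonsing_inv_eq_ringInverse] at hentry
  exact hentry

theorem hasDerivAt_trace_inv_mul (hM : ∀ i j, HasDerivAt (fun t ↦ M t i j) (M' a i j) a)
    (hM' : ∀ i j, HasDerivAt (fun t ↦ M' t i j) (M'' i j) a) (hdet : (M a).det ≠ 0) :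
    HasDerivAt (fun t ↦ ((M t)⁻¹ * M' t).trace)
      (((M a)⁻¹ * M'').trace - ((M a)⁻¹ * M' a * (M a)⁻¹ * M' a).trace) a := by
  have hsum : HasDerivAt (fun t ↦ ∑ i, ∑ j, (M t)⁻¹ i j * M' t j i)
      (∑ i, ∑ j, (-((M a)⁻¹ * M' a * (M a)⁻¹) i j * M' a j i + (M a)⁻¹ i j * M'' j i)) a :=
    HasDerivAt.fun_sum fun i _ ↦ HasDerivAt.fun_sum fun j _ ↦
      (hasDerivAt_inv_apply hM hdet i j).fun_mul (hM' j i)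
  simp only [trace_mul_eq_sum_sum]
  refine hsum.congr_deriv ?_
  simp only [Finset.sum_add_distrib, neg_mul, Finset.sum_neg_distrib]
  ring

variable {lam : ι → ℝ}

theorem inv_diagonal_of_ne_zero (hlam : ∀ i, lam i ≠ 0) :
    (Matrix.diagonal lam)⁻¹ = Matrix.diagonal fun i ↦ (lam i)⁻¹ :=
  Matrix.inv_eq_right_inv <| by simp [Matrix.diagonal_mul_diagonal, hlam]

theorem hasDerivAt_log_det_of_diagonal {M' : Matrix ι ι ℝ}
    (hM : ∀ i j, HasDerivAt (fun t ↦ M t i j) (M' i j) a) (hdiag : M a = Matrix.diagonal lam)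
    (hlam : ∀ i, lam i ≠ 0) :
    HasDerivAt (fun t ↦ Real.log (M t).det) (∑ i, M' i i / lam i) a := by
  have hdet : (M a).det ≠ 0 := by simpa [hdiag, Finset.prod_eq_zero_iff] using hlam
  refine (hasDerivAt_log_det hM hdet).congr_deriv ?_
  simp [hdiag, inv_diagonal_of_ne_zero hlam, Matrix.trace, div_eq_inv_mul]

theorem hasDerivAt_trace_inv_mul_of_diagonal
    (hM : ∀ i j, HasDerivAt (fun t ↦ M t i j) (M' a i j) a)
    (hM' : ∀ i j, HasDerivAt (fun t ↦ M' t i j) (M'' i j) a) (hdiag : M a = Matrix.diagonal lam)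
    (hlam : ∀ i, lam i ≠ 0) :
    HasDerivAt (fun t ↦ ((M t)⁻¹ * M' t).trace)
      (∑ i, M'' i i / lam i - ∑ i, ∑ j, M' a i j * M' a j i / (lam i * lam j)) a := by
  have hdet : (M a).det ≠ 0 := by simpa [hdiag, Finset.prod_eq_zero_iff] using hlam
  refine (hasDerivAt_trace_inv_mul hM hM' hdet).congr_deriv ?_
  rw [hdiag, inv_diagonal_of_ne_zero hlam]
  congr 1
  · simp [Matrix.trace, div_eq_inv_mul]
  · simp only [trace_mul_eq_sum_sum, Matrix.mul_diagonal, Matrix.diagonal_mul]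
    refine Finset.sum_congr rfl fun i _ ↦ Finset.sum_congr rfl fun j _ ↦ ?_
    rw [div_eq_mul_inv, mul_inv]
    ring

end LogDet

section Algebra

variable {ι : Type*}

theorem neg_mul_le_sum_mul [Fintype ι] {s : Finset ι} {x y : ι → ℝ} {X Y : ℝ} (hX : 0 ≤ X)
    (hY : 0 ≤ Y) (hx : ∑ i, x i ^ 2 ≤ X ^ 2) (hy : ∑ i, y i ^ 2 ≤ Y ^ 2) :
    -(X * Y) ≤ ∑ i ∈ s, x i * y i := by
  refine neg_le_of_abs_le (abs_le_of_sq_le_sq ?_ (by positivity))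
  have hxs : ∑ i ∈ s, x i ^ 2 ≤ X ^ 2 :=
    (Finset.sum_le_univ_sum_of_nonneg fun i ↦ sq_nonneg _).trans hx
  have hys : ∑ i ∈ s, y i ^ 2 ≤ Y ^ 2 :=
    (Finset.sum_le_univ_sum_of_nonneg fun i ↦ sq_nonneg _).trans hy
  calc (∑ i ∈ s, x i * y i) ^ 2
    _ ≤ (∑ i ∈ s, x i ^ 2) * ∑ i ∈ s, y i ^ 2 := Finset.sum_mul_sq_le_sq_mul_sq _ _ _
    _ ≤ X ^ 2 * Y ^ 2 := by gcongr
    _ = (X * Y) ^ 2 := by ring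

theorem two_mul_sum_sub_le_sum_sum [Fintype ι] {a : ι → ι → ℝ} (ha : ∀ i j, 0 ≤ a i j)
    (hsymm : ∀ i j, a i j = a j i) (o : ι) : 2 * ∑ i, a o i - a o o ≤ ∑ i, ∑ j, a i j := by
  classical
  have hrow : ∑ i, a o i = a o o + ∑ i ∈ Finset.univ.erase o, a o i :=
    (Finset.add_sum_erase _ _ (Finset.mem_univ o)).symm
  have hcol : ∑ i ∈ Finset.univ.erase o, a o i ≤ ∑ i ∈ Finset.univ.erase o, ∑ j, a i j :=
    Finset.sum_le_sum fun i _ ↦ (hsymm o i).trans_le <|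
      Finset.single_le_sum (fun j _ ↦ ha i j) (Finset.mem_univ o)
  rw [← Finset.add_sum_erase _ (fun i ↦ ∑ j, a i j) (Finset.mem_univ o)]
  linarith

theorem le_add_of_sq_le {s a b : ℝ} (ha : 1 ≤ a) (hb : 0 ≤ b) (h : s ^ 2 ≤ a + b * s) :
    s ≤ a + b := by
  by_contra! hs
  nlinarith

variable [Fintype ι] {lam p g w Q : ι → ℝ} {R T : ι → ι → ℝ} {h₂ : ℝ} {o : ι}

theorem sum_second_order_nonpos (hlam : ∀ i, 0 < lam i) (t : ι → ℝ) (μ : ℝ)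
    (hsecond : ∀ i, -w i ^ 2 + (Q i / μ - t i ^ 2) + (lam i ^ 2 + ∑ k, p k * R i k) ≤ 0)
    (hgrad : ∀ k, ∑ i, R i k / lam i = g k) :
    ∑ i, (lam i - w i ^ 2 / lam i - t i ^ 2 / lam i) + (∑ i, Q i / lam i) / μ
      + ∑ k, p k * g k ≤ 0 := by
  have hswap : ∑ k, p k * g k = ∑ i, (∑ k, p k * R i k) / lam i := by
    simp only [← hgrad, Finset.mul_sum, Finset.sum_div, mul_div_assoc]
    exact Finset.sum_comm
  rw [hswap, Finset.sum_div, ← Finset.sum_add_distrib, ← Finset.sum_add_distrib]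
  refine Finset.sum_nonpos fun i _ ↦ ?_
  have hi := hlam i
  refine le_trans (le_of_eq ?_) (div_nonpos_of_nonpos_of_nonneg (hsecond i) hi.le)
  field_simp
  ring

theorem two_mul_sum_sq_div_sub_le (hlam : ∀ i, 0 < lam i) (hT : ∀ i j, T i j = T j i) (o : ι) :
    2 * ∑ i, (T o i / lam o) ^ 2 / lam i - (T o o / lam o) ^ 2 / lam o
      ≤ (∑ i, ∑ j, T i j * T j i / (lam i * lam j)) / lam o := by
  have hterm : ∀ i, (T o i / lam o) ^ 2 / lam i = T o i * T i o / (lam o * lam i) / lam o :=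
    fun i ↦ by rw [hT i o]; have := hlam i; have := hlam o; field_simp
  simp only [hterm, ← Finset.sum_div, ← mul_div_assoc, ← sub_div]
  refine div_le_div_of_nonneg_right ?_ (hlam o).le
  refine two_mul_sum_sub_le_sum_sum (a := fun i j ↦ T i j * T j i / (lam i * lam j))
    (fun i j ↦ ?_) (fun i j ↦ by rw [mul_comm (T i j), mul_comm (lam i)]) o
  rw [hT j i]
  exact div_nonneg (mul_self_nonneg _) (mul_pos (hlam i) (hlam j)).le

/-- The role of concavity of `log det`: the quadratic third order terms in the twice differentiated
equation absorb those produced by `log ∂ₒ∂ₒu`, with enough to spare to cancel the squared gradient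
of the cut-off in every direction but `o`. -/
theorem pogorelov_key_inequality [DecidableEq ι] (hlam : ∀ i, 0 < lam i)
    (hT : ∀ i j, T i j = T j i)
    (hfirst : ∀ i, w i + T o i / lam o + p i * lam i = 0)
    (hsecond : ∀ i, -w i ^ 2 + (Q i / lam o - (T o i / lam o) ^ 2)
      + (lam i ^ 2 + ∑ k, p k * R i k) ≤ 0)
    (hgrad : ∀ k, ∑ i, R i k / lam i = g k)
    (hhess : ∑ i, Q i / lam i - ∑ i, ∑ j, T i j * T j i / (lam i * lam j) = h₂) :
    2 * ∑ i ∈ Finset.univ.erase o, w i * p i + lam o - w o ^ 2 / lam o + h₂ / lam o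
      + ∑ k, p k * g k ≤ 0 := by
  set t : ι → ℝ := fun i ↦ T o i / lam o
  have hsum := sum_second_order_nonpos hlam t (lam o) hsecond hgrad
  have hthird : 2 * ∑ i, t i ^ 2 / lam i - t o ^ 2 / lam o
      ≤ (∑ i, ∑ j, T i j * T j i / (lam i * lam j)) / lam o := two_mul_sum_sq_div_sub_le hlam hT o
  have hfourth : (∑ i, Q i / lam i) / lam o
      = h₂ / lam o + (∑ i, ∑ j, T i j * T j i / (lam i * lam j)) / lam o := by
    rw [← hhess]; ring
  have hexpand : ∀ i, t i ^ 2 / lam i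
      = w i ^ 2 / lam i + 2 * (w i * p i) + p i ^ 2 * lam i := fun i ↦ by
    have hi := hlam i
    rw [show t i = -(w i + p i * lam i) by linear_combination hfirst i]
    field_simp
    ring
  have hdrop : 2 * ∑ i ∈ Finset.univ.erase o, w i * p i
      ≤ ∑ i ∈ Finset.univ.erase o, (lam i - w i ^ 2 / lam i + t i ^ 2 / lam i) := by
    rw [Finset.mul_sum]
    refine Finset.sum_le_sum fun i _ ↦ ?_
    rw [hexpand i]
    nlinarith [hlam i, mul_nonneg (sq_nonneg (p i)) (hlam i).le]
  have hsplit : lam o - w o ^ 2 / lam o + t o ^ 2 / lam o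
      + ∑ i ∈ Finset.univ.erase o, (lam i - w i ^ 2 / lam i + t i ^ 2 / lam i)
      = ∑ i, (lam i - w i ^ 2 / lam i - t i ^ 2 / lam i) + 2 * ∑ i, t i ^ 2 / lam i := by
    rw [Finset.add_sum_erase _ (fun i ↦ lam i - w i ^ 2 / lam i + t i ^ 2 / lam i)
      (Finset.mem_univ o), Finset.mul_sum, ← Finset.sum_add_distrib]
    exact Finset.sum_congr rfl fun i _ ↦ by ring
  linarith

theorem sq_le_of_pogorelov_conditions {l A B M : ℝ} {m : ι → ℝ} (hl : 0 < l) (hA : 0 ≤ A)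
    (hM : 0 ≤ M) (hlam : ∀ i, 0 < lam i) (hm : ∑ i, m i ^ 2 ≤ 1) (hp : ∑ i, p i ^ 2 ≤ M ^ 2)
    (hg : ∑ i, g i ^ 2 ≤ A ^ 2) (hh₂ : -B ≤ h₂) (hT : ∀ i j, T i j = T j i)
    (hfirst : ∀ i, m i / l + T o i / lam o + p i * lam i = 0)
    (hsecond : ∀ i, -(m i / l) ^ 2 + (Q i / lam o - (T o i / lam o) ^ 2)
      + (lam i ^ 2 + ∑ k, p k * R i k) ≤ 0)
    (hgrad : ∀ k, ∑ i, R i k / lam i = g k)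
    (hhess : ∑ i, Q i / lam i - ∑ i, ∑ j, T i j * T j i / (lam i * lam j) = h₂) :
    (l * lam o) ^ 2 ≤ 1 + l ^ 2 * B + (2 * M + M * A * l) * (l * lam o) := by
  classical
  have hlo := hlam o
  have hkey := pogorelov_key_inequality hlam hT hfirst hsecond hgrad hhess
  have hmp : -(1 * M) ≤ ∑ i ∈ Finset.univ.erase o, m i * p i :=
    neg_mul_le_sum_mul zero_le_one hM (by simpa using hm) hp
  have hpg : -(M * A) ≤ ∑ k, p k * g k := neg_mul_le_sum_mul hM hA hp hg
  have hmo : m o ^ 2 ≤ 1 :=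
    (Finset.single_le_sum (fun i _ ↦ sq_nonneg (m i)) (Finset.mem_univ o)).trans hm
  have hscaled : 2 * (l * lam o) * ∑ i ∈ Finset.univ.erase o, m i * p i + (l * lam o) ^ 2
      - m o ^ 2 + l ^ 2 * h₂ + l ^ 2 * lam o * ∑ k, p k * g k ≤ 0 := by
    refine le_trans (le_of_eq ?_) (mul_nonpos_of_nonneg_of_nonpos (a := l ^ 2 * lam o)
      (by positivity) hkey)
    simp only [div_mul_eq_mul_div, ← Finset.sum_div]
    field_simp
  have hmp' := mul_le_mul_of_nonneg_left hmp (by positivity : 0 ≤ 2 * (l * lam o))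
  have hpg' := mul_le_mul_of_nonneg_left hpg (by positivity : 0 ≤ l ^ 2 * lam o)
  have hh₂' := mul_le_mul_of_nonneg_left hh₂ (sq_nonneg l)
  linarith

end Algebra

section BilinearForm

open InnerProductSpace

variable {E : Type*} [NormedAddCommGroup E] [InnerProductSpace ℝ E] [FiniteDimensional ℝ E]
variable {ι : Type*} [Fintype ι]

local postfix:1024 "♯" => continuousLinearMapOfBilin (𝕜 := ℝ)

theorem sum_sq_apply_eq_sq_norm (b : OrthonormalBasis ι ℝ E) (L : E →L[ℝ] ℝ) :
    ∑ i, L (b i) ^ 2 = ‖L‖ ^ 2 := by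
  simpa using b.sum_sq_norm_inner_left ((toDual ℝ E).symm L)

/-- The matrix of the bilinear form `B` in the basis `b`. -/
noncomputable def formMatrix (b : OrthonormalBasis ι ℝ E) (B : E →L[ℝ] E →L[ℝ] ℝ) : Matrix ι ι ℝ :=
  Matrix.of fun i j ↦ B (b i) (b j)

/-- The determinant of the bilinear form `B`, that is, of its matrix in any orthonormal basis. -/
noncomputable def formDet (B : E →L[ℝ] E →L[ℝ] ℝ) : ℝ := LinearMap.det (B♯ : E →ₗ[ℝ] E)

theorem det_formMatrix [DecidableEq ι] (b : OrthonormalBasis ι ℝ E) (B : E →L[ℝ] E →L[ℝ] ℝ) :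
    (formMatrix b B).det = formDet B := by
  rw [formDet, ← LinearMap.det_toMatrix b.toBasis, ← Matrix.det_transpose]
  congr 1
  ext i j
  rw [Matrix.transpose_apply, LinearMap.toMatrix_apply]
  simpa [formMatrix, b.repr_apply_apply, real_inner_comm (b i)] using
    (continuousLinearMapOfBilin_apply B (b j) (b i)).symm

theorem norm_le_of_diagonal_le [DecidableEq ι] (b : OrthonormalBasis ι ℝ E)
    {B : E →L[ℝ] E →L[ℝ] ℝ} {lam : ι → ℝ} (hB : formMatrix b B = Matrix.diagonal lam) {c : ℝ}
    (hc : 0 ≤ c) (hlam : ∀ i, |lam i| ≤ c) : ‖B‖ ≤ c := by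
  refine B.opNorm_le_bound hc fun v ↦ abs_le_of_sq_le_sq' ?_ (by positivity) |>.2
  have hentry : ∀ i, B v (b i) = lam i * inner ℝ (b i) v := fun i ↦ by
    have hdiag : ∀ j, B (b j) (b i) = Matrix.diagonal lam j i := fun j ↦ congr_fun₂ hB j i
    conv_lhs => rw [← b.sum_repr' v]
    simp [hdiag, Matrix.diagonal_apply, mul_comm]
  calc ‖B v‖ ^ 2
    _ = ∑ i, (lam i * inner ℝ (b i) v) ^ 2 := by simp only [← sum_sq_apply_eq_sq_norm b, hentry]
    _ ≤ ∑ i, c ^ 2 * inner ℝ (b i) v ^ 2 := by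
      gcongr with i
      rw [mul_pow]
      exact mul_le_mul_of_nonneg_right (sq_le_sq' (abs_le.1 (hlam i)).1 (abs_le.1 (hlam i)).2)
        (sq_nonneg _)
    _ = (c * ‖v‖) ^ 2 := by
      rw [← Finset.mul_sum, mul_pow, ← b.sum_sq_norm_inner_right v]
      simp

theorem exists_orthonormalBasis_formMatrix_eq_diagonal {B : E →L[ℝ] E →L[ℝ] ℝ}
    (hB : ∀ v w, B v w = B w v) :
    ∃ (b : OrthonormalBasis (Fin (Module.finrank ℝ E)) ℝ E) (lam : Fin (Module.finrank ℝ E) → ℝ),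
      formMatrix b B = Matrix.diagonal lam := by
  have hsymm : (B♯ : E →ₗ[ℝ] E).IsSymmetric := fun v w ↦ by
    rw [real_inner_comm _ v]
    exact (continuousLinearMapOfBilin_apply B v w).trans <|
      (hB v w).trans (continuousLinearMapOfBilin_apply B w v).symm
  refine ⟨hsymm.eigenvectorBasis rfl, hsymm.eigenvalues rfl, Matrix.ext fun i j ↦ ?_⟩
  calc B (hsymm.eigenvectorBasis rfl i) (hsymm.eigenvectorBasis rfl j)
    _ = inner ℝ (B♯ (hsymm.eigenvectorBasis rfl i)) (hsymm.eigenvectorBasis rfl j) :=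
      (continuousLinearMapOfBilin_apply B _ _).symm
    _ = inner ℝ (hsymm.eigenvalues rfl i • hsymm.eigenvectorBasis rfl i)
          (hsymm.eigenvectorBasis rfl j) :=
      congrArg (inner ℝ · _) (hsymm.apply_eigenvectorBasis rfl i)
    _ = Matrix.diagonal (hsymm.eigenvalues rfl) i j := by
      rw [real_inner_smul_left, orthonormal_iff_ite.1 (hsymm.eigenvectorBasis rfl).orthonormal,
        Matrix.diagonal_apply, mul_ite, mul_one, mul_zero]

theorem exists_diagonal_pos_norm_eq [Nontrivial E] {B : E →L[ℝ] E →L[ℝ] ℝ}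
    (hsymm : ∀ v w, B v w = B w v) (hB : ∀ v, 0 ≤ B v v)
    (hdet : formDet B ≠ 0) :
    ∃ (b : OrthonormalBasis (Fin (Module.finrank ℝ E)) ℝ E) (lam : Fin (Module.finrank ℝ E) → ℝ)
      (o : Fin (Module.finrank ℝ E)), formMatrix b B = Matrix.diagonal lam ∧ (∀ i, 0 < lam i) ∧
        lam o = ‖B‖ := by
  obtain ⟨b, lam, hdiag⟩ := exists_orthonormalBasis_formMatrix_eq_diagonal hsymm
  have hentry : ∀ i, B (b i) (b i) = lam i := fun i ↦ by
    simpa [formMatrix] using congr_fun₂ hdiag i i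
  rw [← det_formMatrix b, hdiag, Matrix.det_diagonal, Finset.prod_ne_zero_iff] at hdet
  have hpos : ∀ i, 0 < lam i := fun i ↦
    (hentry i ▸ hB (b i)).lt_of_ne' (hdet i (Finset.mem_univ i))
  have : Nonempty (Fin (Module.finrank ℝ E)) := Fin.pos_iff_nonempty.1 Module.finrank_pos
  obtain ⟨o, ho⟩ := Finite.exists_max lam
  refine ⟨b, lam, o, hdiag, hpos, le_antisymm ?_ <|
    norm_le_of_diagonal_le b hdiag (hpos o).le fun i ↦ (abs_of_pos (hpos i)).trans_le (ho i)⟩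
  simpa [hentry] using (le_abs_self _).trans (B.le_opNorm₂ (b o) (b o))

end BilinearForm

theorem det_hessianMatrix {n : ℕ} (u : EuclideanSpace ℝ (Fin n) → ℝ)
    (x : EuclideanSpace ℝ (Fin n)) :
    (hessianMatrix u x).det = formDet (fderiv ℝ (fderiv ℝ u) x) := by
  rw [← det_formMatrix (EuclideanSpace.basisFun (Fin n) ℝ)]
  congr 1
  ext i j
  simp [hessianMatrix, formMatrix, iteratedFDeriv_two_apply]

section MongeAmpere

variable {E : Type*} [NormedAddCommGroup E] [InnerProductSpace ℝ E]

theorem formMatrix_fderiv_fderiv {ι : Type*} [Fintype ι] (b : OrthonormalBasis ι ℝ E) {u : E → ℝ}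
    {y : E} (hu : ContDiffAt ℝ 2 u y) :
    formMatrix b (fderiv ℝ (fderiv ℝ u) y) = Matrix.of fun i j ↦ ∂[b i] (∂[b j] u) y := by
  simp only [formMatrix, dirDeriv_dirDeriv_apply hu]

variable [FiniteDimensional ℝ E]

/-- `u` is a solution of class `C⁴` with positive semidefinite Hessian of the Monge–Ampère equation
`det ∇²u = eʰ` on the open set `V`. -/
structure IsMongeAmpereSolution (u h : E → ℝ) (V : Set E) : Prop where
  isOpen : IsOpen V
  contDiffOn : ContDiffOn ℝ 4 u V
  hess_nonneg : ∀ y ∈ V, ∀ v, 0 ≤ fderiv ℝ (fderiv ℝ u) y v v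
  det_eq_exp : ∀ y ∈ V, formDet (fderiv ℝ (fderiv ℝ u) y) = Real.exp (h y)

namespace IsMongeAmpereSolution

variable {u h : E → ℝ} {V : Set E} {x : E}

theorem contDiffAt (hu : IsMongeAmpereSolution u h V) (hx : x ∈ V) : ContDiffAt ℝ 4 u x :=
  hu.contDiffOn.contDiffAt (hu.isOpen.mem_nhds hx)

theorem det_eq (hu : IsMongeAmpereSolution u h V) {ι : Type*} [Fintype ι] [DecidableEq ι]
    (b : OrthonormalBasis ι ℝ E) (hx : x ∈ V) :
    (Matrix.of fun i j ↦ ∂[b i] (∂[b j] u) x).det = Real.exp (h x) := by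
  rw [← formMatrix_fderiv_fderiv b ((hu.contDiffAt hx).of_le (by norm_num)), det_formMatrix,
    hu.det_eq_exp x hx]

theorem contDiffAt_right (hu : IsMongeAmpereSolution u h V) (hx : x ∈ V) : ContDiffAt ℝ 2 h x := by
  let b := stdOrthonormalBasis ℝ E
  have hdet : ContDiffAt ℝ 2 (fun y ↦ (Matrix.of fun i j ↦ ∂[b i] (∂[b j] u) y).det) x := by
    simp only [Matrix.det_apply', Matrix.of_apply]
    exact ContDiffAt.sum fun σ _ ↦ contDiffAt_const.mul <| contDiffAt_prod fun i _ ↦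
      contDiffAt_dirDeriv_dirDeriv (hu.contDiffAt hx) (by norm_num) _ _
  refine (hdet.log (by simp [hu.det_eq b hx])).congr_of_eventuallyEq ?_
  filter_upwards [hu.isOpen.mem_nhds hx] with y hy
  rw [hu.det_eq b hy, Real.log_exp]

variable {ι : Type*} [Fintype ι] [DecidableEq ι] {b : OrthonormalBasis ι ℝ E} {lam : ι → ℝ}

theorem log_det_line_eventuallyEq (hu : IsMongeAmpereSolution u h V) (hx : x ∈ V) (v : E) :
    (fun t : ℝ ↦ Real.log (Matrix.of fun i j ↦ ∂[b i] (∂[b j] u) (x + t • v)).det)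
      =ᶠ[𝓝 0] fun t ↦ h (x + t • v) := by
  filter_upwards [tendsto_line x v (hu.isOpen.mem_nhds hx)] with t ht
  rw [hu.det_eq b ht, Real.log_exp]

theorem trace_inv_mul_line_eventuallyEq (hu : IsMongeAmpereSolution u h V) (hx : x ∈ V) (v : E) :
    (fun t : ℝ ↦ ((Matrix.of fun i j ↦ ∂[b i] (∂[b j] u) (x + t • v))⁻¹
        * Matrix.of fun i j ↦ ∂[v] (∂[b i] (∂[b j] u)) (x + t • v)).trace)
      =ᶠ[𝓝 0] fun t ↦ ∂[v] h (x + t • v) := by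
  have hentry : ∀ᶠ t : ℝ in 𝓝 0, ∀ i j, HasDerivAt (fun s : ℝ ↦ ∂[b i] (∂[b j] u) (x + s • v))
      (∂[v] (∂[b i] (∂[b j] u)) (x + t • v)) t :=
    eventually_all.2 fun i ↦ eventually_all.2 fun j ↦ eventually_hasDerivAt_line
      (contDiffAt_dirDeriv_dirDeriv (hu.contDiffAt hx) (by norm_num) _ _) v
  filter_upwards [hentry, (log_det_line_eventuallyEq (b := b) hu hx v).eventuallyEq_nhds,
    tendsto_line x v (hu.isOpen.mem_nhds hx),
    eventually_hasDerivAt_line ((hu.contDiffAt_right hx).of_le (by norm_num)) v]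
    with t hentry hlog ht hh
  have hdet := hasDerivAt_log_det
    (M := fun s ↦ Matrix.of fun i j ↦ ∂[b i] (∂[b j] u) (x + s • v))
    (M' := Matrix.of fun i j ↦ ∂[v] (∂[b i] (∂[b j] u)) (x + t • v)) hentry
    (by simp [hu.det_eq b ht])
  exact hdet.unique (hh.congr_of_eventuallyEq hlog)

theorem sum_dirDeriv_hess_div_eq (hu : IsMongeAmpereSolution u h V) (hx : x ∈ V)
    (hdiag : formMatrix b (fderiv ℝ (fderiv ℝ u) x) = Matrix.diagonal lam)
    (hlam : ∀ i, lam i ≠ 0) (v : E) :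
    ∑ i, ∂[v] (∂[b i] (∂[b i] u)) x / lam i = ∂[v] h x := by
  rw [formMatrix_fderiv_fderiv b ((hu.contDiffAt hx).of_le (by norm_num))] at hdiag
  have hdet := hasDerivAt_log_det_of_diagonal (a := 0) (lam := lam)
    (M := fun t ↦ Matrix.of fun i j ↦ ∂[b i] (∂[b j] u) (x + t • v))
    (M' := Matrix.of fun i j ↦ ∂[v] (∂[b i] (∂[b j] u)) x)
    (fun i j ↦ hasDerivAt_line
      (contDiffAt_dirDeriv_dirDeriv (hu.contDiffAt hx) (by norm_num) _ _) v)
    (by simpa using hdiag) hlam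
  have hh := hasDerivAt_line ((hu.contDiffAt_right hx).of_le (by norm_num)) v
  exact hdet.unique (hh.congr_of_eventuallyEq (hu.log_det_line_eventuallyEq hx v))

theorem sum_dirDeriv_dirDeriv_hess_div_sub_eq (hu : IsMongeAmpereSolution u h V) (hx : x ∈ V)
    (hdiag : formMatrix b (fderiv ℝ (fderiv ℝ u) x) = Matrix.diagonal lam)
    (hlam : ∀ i, lam i ≠ 0) (v : E) :
    ∑ i, ∂[v] (∂[v] (∂[b i] (∂[b i] u))) x / lam i
        - ∑ i, ∑ j, ∂[v] (∂[b i] (∂[b j] u)) x * ∂[v] (∂[b j] (∂[b i] u)) x / (lam i * lam j)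
      = ∂[v] (∂[v] h) x := by
  rw [formMatrix_fderiv_fderiv b ((hu.contDiffAt hx).of_le (by norm_num))] at hdiag
  have hhess : ∀ i j, ContDiffAt ℝ 2 (∂[b i] (∂[b j] u)) x := fun i j ↦
    contDiffAt_dirDeriv_dirDeriv (hu.contDiffAt hx) (by norm_num) _ _
  have htrace := hasDerivAt_trace_inv_mul_of_diagonal (a := 0) (lam := lam)
    (M := fun t ↦ Matrix.of fun i j ↦ ∂[b i] (∂[b j] u) (x + t • v))
    (M' := fun t ↦ Matrix.of fun i j ↦ ∂[v] (∂[b i] (∂[b j] u)) (x + t • v))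
    (M'' := Matrix.of fun i j ↦ ∂[v] (∂[v] (∂[b i] (∂[b j] u))) x)
    (fun i j ↦ by simpa using hasDerivAt_line ((hhess i j).of_le (by norm_num)) v)
    (fun i j ↦ hasDerivAt_line (contDiffAt_dirDeriv (hhess i j) (by norm_num) v) v)
    (by simpa using hdiag) hlam
  have hh := hasDerivAt_line (contDiffAt_dirDeriv (hu.contDiffAt_right hx) (by norm_num) v) v
  simpa using htrace.unique (hh.congr_of_eventuallyEq (hu.trace_inv_mul_line_eventuallyEq hx v))

end IsMongeAmpereSolution

end MongeAmpere

section TestFunction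

theorem isLocalMax_log_add_log_add {X : Type*} [TopologicalSpace X] {l w N G : X → ℝ} {x : X}
    (hmax : IsLocalMax (fun y ↦ l y * N y * Real.exp (G y)) x) (hl : ContinuousAt l x)
    (hw : ContinuousAt w x) (hl₀ : 0 < l x) (hw₀ : 0 < w x) (hwN : ∀ᶠ y in 𝓝 x, w y ≤ N y)
    (hwx : w x = N x) : IsLocalMax (fun y ↦ Real.log (l y) + Real.log (w y) + G y) x := by
  have hlog : ∀ y, 0 < l y → 0 < w y →
      Real.log (l y) + Real.log (w y) + G y = Real.log (l y * w y * Real.exp (G y)) :=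
    fun y hly hwy ↦ by
      rw [Real.log_mul (by positivity) (by positivity), Real.log_mul hly.ne' hwy.ne', Real.log_exp]
  filter_upwards [hmax, hwN, hl.eventually_const_lt hl₀, hw.eventually_const_lt hw₀]
    with y hy hwNy hly hwy
  rw [hlog y hly hwy, hlog x hl₀ hw₀, hwx]
  refine Real.log_le_log (by positivity) (le_trans ?_ hy)
  gcongr

variable {E : Type*} [NormedAddCommGroup E] [InnerProductSpace ℝ E] {e x : E} {c : ℝ}

theorem dirDeriv_inner_sub (e v : E) (c : ℝ) :
    (∂[v] fun y ↦ inner ℝ e y - c) = fun _ ↦ inner ℝ e v := by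
  ext y
  have hderiv : HasFDerivAt (fun y ↦ inner ℝ e y - c) (innerSL ℝ e) y :=
    (innerSL ℝ e).hasFDerivAt.sub_const c
  simp [dirDeriv, hderiv.fderiv]

theorem conditions_of_isLocalMax_log {ι : Type*} [Fintype ι] {W : E → ℝ} {P : ι → E → ℝ}
    (hl : inner ℝ e x - c ≠ 0) (hW : ContDiffAt ℝ 2 W x) (hW₀ : W x ≠ 0)
    (hP : ∀ k, ContDiffAt ℝ 2 (P k) x)
    (hmax : IsLocalMax (fun y ↦ Real.log (inner ℝ e y - c) + Real.log (W y)
      + (∑ k, P k y ^ 2) / 2) x) (v : E) :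
    inner ℝ e v / (inner ℝ e x - c) + ∂[v] W x / W x + ∑ k, P k x * ∂[v] (P k) x = 0 ∧
      -(inner ℝ e v / (inner ℝ e x - c)) ^ 2
        + (∂[v] (∂[v] W) x / W x - (∂[v] W x / W x) ^ 2)
        + ∑ k, (∂[v] (P k) x ^ 2 + P k x * ∂[v] (∂[v] (P k)) x) ≤ 0 := by
  have hcut : ContDiffAt ℝ 2 (fun y ↦ inner ℝ e y - c) x :=
    (contDiffAt_const.inner ℝ contDiffAt_id).sub contDiffAt_const
  have hlogl : ContDiffAt ℝ 2 (fun y ↦ Real.log (inner ℝ e y - c)) x := hcut.log hl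
  have hlogW : ContDiffAt ℝ 2 (fun y ↦ Real.log (W y)) x := hW.log hW₀
  have hsq : ContDiffAt ℝ 2 (fun y ↦ (∑ k, P k y ^ 2) / 2) x :=
    (ContDiffAt.sum fun k _ ↦ (hP k).pow 2).div_const 2
  have hdiff : ∀ {g : E → ℝ}, ContDiffAt ℝ 2 g x → DifferentiableAt ℝ g x :=
    fun hg ↦ hg.differentiableAt two_ne_zero
  constructor
  · have hcrit : ∂[v] (fun y ↦ Real.log (inner ℝ e y - c) + Real.log (W y)
        + (∑ k, P k y ^ 2) / 2) x = 0 := by simp [dirDeriv, hmax.fderiv_eq_zero]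
    rwa [dirDeriv_add (hdiff (hlogl.add hlogW)) (hdiff hsq),
      dirDeriv_add (hdiff hlogl) (hdiff hlogW), dirDeriv_log (hdiff hcut) hl,
      dirDeriv_log (hdiff hW) hW₀, dirDeriv_inner_sub,
      dirDeriv_half_sum_sq fun k ↦ hdiff (hP k)] at hcrit
  · have hconc := dirDeriv_dirDeriv_nonpos_of_isLocalMax hmax ((hlogl.add hlogW).add hsq) v
    rw [dirDeriv_dirDeriv_add (hlogl.add hlogW) hsq, dirDeriv_dirDeriv_add hlogl hlogW,
      dirDeriv_dirDeriv_log hcut hl, dirDeriv_dirDeriv_log hW hW₀,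
      dirDeriv_dirDeriv_half_sum_sq hP, dirDeriv_inner_sub] at hconc
    simpa [dirDeriv] using hconc

variable [FiniteDimensional ℝ E] {u h : E → ℝ} {V : Set E} {A B M d : ℝ}

theorem sq_mul_hess_le_of_isLocalMax_log {ι : Type*} [Fintype ι] [DecidableEq ι]
    {b : OrthonormalBasis ι ℝ E} {lam : ι → ℝ} {o : ι} (hu : IsMongeAmpereSolution u h V)
    (hx : x ∈ V) (hdiag : formMatrix b (fderiv ℝ (fderiv ℝ u) x) = Matrix.diagonal lam)
    (hlam : ∀ i, 0 < lam i) (he : ‖e‖ = 1) (hl : 0 < inner ℝ e x - c) (hM : ‖fderiv ℝ u x‖ ≤ M)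
    (hA : ‖fderiv ℝ h x‖ ≤ A) (hB : -B ≤ ∂[b o] (∂[b o] h) x)
    (hmax : IsLocalMax (fun y ↦ Real.log (inner ℝ e y - c) + Real.log (∂[b o] (∂[b o] u) y)
      + (∑ k, ∂[b k] u y ^ 2) / 2) x) :
    ((inner ℝ e x - c) * lam o) ^ 2 ≤ 1 + (inner ℝ e x - c) ^ 2 * B
      + (2 * M + M * A * (inner ℝ e x - c)) * ((inner ℝ e x - c) * lam o) := by
  have hu₄ := hu.contDiffAt hx
  have hu₃ : ContDiffAt ℝ 3 u x := hu₄.of_le (by norm_num)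
  have hhess : ∀ i j, ∂[b i] (∂[b j] u) x = if i = j then lam i else 0 := fun i j ↦ by
    have hentry := congr_fun₂ ((formMatrix_fderiv_fderiv b (hu₄.of_le (by norm_num))).symm.trans
      hdiag) i j
    simpa [Matrix.diagonal_apply] using hentry
  have hcond (i : ι) := conditions_of_isLocalMax_log hl.ne'
    (contDiffAt_dirDeriv_dirDeriv hu₄ (by norm_num) (b o) (b o)) (by simp [hhess, (hlam o).ne'])
    (fun k ↦ contDiffAt_dirDeriv hu₄ (by norm_num) (b k)) hmax (b i)
  simp only [hhess, mul_ite, mul_zero, ite_pow, Finset.sum_add_distrib, Finset.sum_ite_eq,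
    Finset.mem_univ, if_true, zero_pow two_ne_zero] at hcond
  refine sq_le_of_pogorelov_conditions (m := fun i ↦ inner ℝ e (b i)) (p := fun i ↦ ∂[b i] u x)
    (g := fun i ↦ ∂[b i] h x) (Q := fun i ↦ ∂[b i] (∂[b i] (∂[b o] (∂[b o] u))) x)
    (R := fun i k ↦ ∂[b i] (∂[b i] (∂[b k] u)) x) (T := fun i j ↦ ∂[b o] (∂[b i] (∂[b j] u)) x)
    hl ((norm_nonneg _).trans hA) ((norm_nonneg _).trans hM) hlam ?_ ?_ ?_ hB ?_ ?_ ?_ ?_ ?_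
  · simpa [he] using (b.sum_sq_norm_inner_left e).le
  · exact (sum_sq_apply_eq_sq_norm b (fderiv ℝ u x)).trans_le (by gcongr)
  · exact (sum_sq_apply_eq_sq_norm b (fderiv ℝ h x)).trans_le (by gcongr)
  · exact fun i j ↦ (dirDeriv_eventuallyEq
      (dirDeriv_comm (hu₃.of_le (by norm_num)) (b i) (b j)) (b o)).self_of_nhds
  · intro i
    simpa only [(dirDeriv_comm₃ hu₃ (b o) (b o) (b i)).self_of_nhds] using (hcond i).1
  · intro i
    simpa only [(dirDeriv_comm₃ hu₃ (b o) (b o) (b i)).self_of_nhds] using (hcond i).2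
  · intro k
    simpa only [(dirDeriv_comm₃ hu₃ _ _ (b k)).self_of_nhds] using
      hu.sum_dirDeriv_hess_div_eq hx hdiag (fun i ↦ (hlam i).ne') (b k)
  · simpa only [(dirDeriv_comm₄ hu₄ (b o) _).self_of_nhds] using
      hu.sum_dirDeriv_dirDeriv_hess_div_sub_eq hx hdiag (fun i ↦ (hlam i).ne') (b o)

theorem mul_norm_hess_le_of_isLocalMax (hu : IsMongeAmpereSolution u h V) (hx : x ∈ V)
    (he : ‖e‖ = 1) (hl : 0 < inner ℝ e x - c) (hd : inner ℝ e x - c ≤ d)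
    (hM : ‖fderiv ℝ u x‖ ≤ M) (hA : ‖fderiv ℝ h x‖ ≤ A) (hB : ‖fderiv ℝ (fderiv ℝ h) x‖ ≤ B)
    (hmax : IsLocalMax (fun y ↦ (inner ℝ e y - c) * ‖fderiv ℝ (fderiv ℝ u) y‖
      * Real.exp (‖fderiv ℝ u y‖ ^ 2 / 2)) x) :
    (inner ℝ e x - c) * ‖fderiv ℝ (fderiv ℝ u) x‖ ≤ 1 + d ^ 2 * B + 2 * M + M * A * d := by
  have : Nontrivial E := nontrivial_of_ne e 0 (by rintro rfl; simp at he)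
  have hu₂ : ∀ {y}, y ∈ V → ContDiffAt ℝ 2 u y := fun hy ↦ (hu.contDiffAt hy).of_le (by norm_num)
  have hA₀ := (norm_nonneg _).trans hA
  have hB₀ := (norm_nonneg (fderiv ℝ (fderiv ℝ h) x)).trans hB
  have hM₀ := (norm_nonneg _).trans hM
  obtain ⟨b, lam, o, hdiag, hlam, hlamo⟩ := exists_diagonal_pos_norm_eq
    (fun v w ↦ ((hu₂ hx).isSymmSndFDerivAt (by simp)).eq v w) (hu.hess_nonneg x hx)
    (by simp [hu.det_eq_exp x hx])
  have hnorm : ∀ B : E →L[ℝ] E →L[ℝ] ℝ, |B (b o) (b o)| ≤ ‖B‖ := fun B ↦ by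
    simpa using B.le_opNorm₂ (b o) (b o)
  have hWx : ∂[b o] (∂[b o] u) x = ‖fderiv ℝ (fderiv ℝ u) x‖ := by
    have hentry := congr_fun₂ hdiag o o
    rw [dirDeriv_dirDeriv_apply (hu₂ hx), ← hlamo]
    simpa [formMatrix] using hentry
  have hW : ∀ᶠ y in 𝓝 x, ∂[b o] (∂[b o] u) y ≤ ‖fderiv ℝ (fderiv ℝ u) y‖ := by
    filter_upwards [hu.isOpen.mem_nhds hx] with y hy
    rw [dirDeriv_dirDeriv_apply (hu₂ hy)]
    exact (le_abs_self _).trans (hnorm _)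
  have hmax_log := isLocalMax_log_add_log_add hmax (by fun_prop)
    (contDiffAt_dirDeriv_dirDeriv (k := 0) (hu.contDiffAt hx) (by norm_num) _ _).continuousAt
    hl (by rw [hWx, ← hlamo]; exact hlam o) hW hWx
  simp only [← sum_sq_apply_eq_sq_norm b] at hmax_log
  have hhess : -B ≤ ∂[b o] (∂[b o] h) x := by
    rw [dirDeriv_dirDeriv_apply (hu.contDiffAt_right hx)]
    exact neg_le_of_abs_le ((hnorm _).trans hB)
  have hsq := sq_mul_hess_le_of_isLocalMax_log hu hx hdiag hlam he hl hM hA hhess hmax_log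
  rw [hlamo] at hsq
  have hle := le_add_of_sq_le (le_add_of_nonneg_right (by positivity)) (by positivity) hsq
  calc (inner ℝ e x - c) * ‖fderiv ℝ (fderiv ℝ u) x‖
    _ ≤ 1 + (inner ℝ e x - c) ^ 2 * B + (2 * M + M * A * (inner ℝ e x - c)) := hle
    _ ≤ 1 + d ^ 2 * B + (2 * M + M * A * d) := by gcongr
    _ = 1 + d ^ 2 * B + 2 * M + M * A * d := by ring

end TestFunction

section HalfSpace

variable {E : Type*} [NormedAddCommGroup E] [InnerProductSpace ℝ E] {u : E → ℝ} {S V : Set E}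
  {e x : E} {c : ℝ}

/-- Pogorelov's test function for the maximum principle, with cut-off the affine function
`⟪e, y⟫ - c`. Derivatives are taken within `S`, so that it makes sense up to the boundary. -/
noncomputable def pogorelovWeight (e : E) (c : ℝ) (u : E → ℝ) (S : Set E) (y : E) : ℝ :=
  (inner ℝ e y - c) * ‖iteratedFDerivWithin ℝ 2 u S y‖ * Real.exp (‖fderivWithin ℝ u S y‖ ^ 2 / 2)

theorem continuousOn_pogorelovWeight (hS : UniqueDiffOn ℝ S) (hu : ContDiffOn ℝ 2 u S) :
    ContinuousOn (pogorelovWeight e c u S) S := by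
  have hcut : Continuous fun y ↦ inner ℝ e y - c := by fun_prop
  exact (hcut.continuousOn.mul
    (hu.continuousOn_iteratedFDerivWithin le_rfl hS).norm).mul
    (((hu.continuousOn_fderivWithin hS (by norm_num)).norm.pow 2).div_const 2).rexp

theorem norm_iteratedFDeriv_two (u : E → ℝ) (x : E) :
    ‖iteratedFDeriv ℝ 2 u x‖ = ‖fderiv ℝ (fderiv ℝ u) x‖ := by
  rw [← norm_iteratedFDeriv_one, norm_iteratedFDeriv_fderiv]

theorem iteratedFDerivWithin_of_mem_nhds (hS : S ∈ 𝓝 x) (k : ℕ) :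
    iteratedFDerivWithin ℝ k u S x = iteratedFDeriv ℝ k u x := by
  rw [iteratedFDerivWithin_congr_set (eventuallyEq_univ.2 hS), iteratedFDerivWithin_univ]

theorem pogorelovWeight_of_mem_nhds (hS : S ∈ 𝓝 x) : pogorelovWeight e c u S x =
    (inner ℝ e x - c) * ‖fderiv ℝ (fderiv ℝ u) x‖ * Real.exp (‖fderiv ℝ u x‖ ^ 2 / 2) := by
  rw [pogorelovWeight, iteratedFDerivWithin_of_mem_nhds hS, norm_iteratedFDeriv_two,
    fderivWithin_of_mem_nhds hS]

theorem isLocalMax_of_isMaxOn_pogorelovWeight (hV : IsOpen V) (hVS : V ⊆ S) (hx : x ∈ V)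
    (hl : c < inner ℝ e x)
    (hmax : IsMaxOn (pogorelovWeight e c u S) {y ∈ S | c ≤ inner ℝ e y} x) :
    IsLocalMax (fun y ↦ (inner ℝ e y - c) * ‖fderiv ℝ (fderiv ℝ u) y‖
      * Real.exp (‖fderiv ℝ u y‖ ^ 2 / 2)) x := by
  have hSV : ∀ y ∈ V, S ∈ 𝓝 y := fun y hy ↦ mem_of_superset (hV.mem_nhds hy) hVS
  have hcont : Continuous fun y ↦ inner ℝ e y := by fun_prop
  filter_upwards [hV.mem_nhds hx, hcont.continuousAt.eventually_const_lt hl] with y hy hly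
  rw [← pogorelovWeight_of_mem_nhds (hSV y hy), ← pogorelovWeight_of_mem_nhds (hSV x hx)]
  exact hmax ⟨hVS hy, hly.le⟩

variable [FiniteDimensional ℝ E] {h : E → ℝ} {A B M H d : ℝ}

theorem mul_norm_hess_le_of_halfSpace (hS : UniqueDiffOn ℝ S) (hu₂ : ContDiffOn ℝ 2 u S)
    (hu : IsMongeAmpereSolution u h V) (hVS : V ⊆ S) (he : ‖e‖ = 1)
    (hK : IsCompact {y ∈ S | c ≤ inner ℝ e y}) (hA : ∀ y ∈ V, ‖fderiv ℝ h y‖ ≤ A)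
    (hB : ∀ y ∈ V, ‖fderiv ℝ (fderiv ℝ h) y‖ ≤ B) (hM : ∀ y ∈ S, ‖fderivWithin ℝ u S y‖ ≤ M)
    (hH : ∀ y ∈ S \ V, ‖iteratedFDerivWithin ℝ 2 u S y‖ ≤ H) (hH₀ : 0 ≤ H)
    (hd : ∀ y ∈ S, inner ℝ e y - c ≤ d) (hx : x ∈ V) (hcx : c ≤ inner ℝ e x) :
    (inner ℝ e x - c) * ‖iteratedFDeriv ℝ 2 u x‖ ≤
      Real.exp (M ^ 2 / 2) * (1 + d ^ 2 * B + 2 * M + M * A * d + d * H) := by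
  have hA₀ := (norm_nonneg _).trans (hA x hx)
  have hB₀ := (norm_nonneg (fderiv ℝ (fderiv ℝ h) x)).trans (hB x hx)
  have hM₀ := (norm_nonneg _).trans (hM x (hVS hx))
  have hd₀ := (sub_nonneg.2 hcx).trans (hd x (hVS hx))
  have hSV : ∀ y ∈ V, S ∈ 𝓝 y := fun y hy ↦ mem_of_superset (hu.isOpen.mem_nhds hy) hVS
  obtain ⟨y, ⟨hyS, hcy⟩, hmax⟩ := hK.exists_isMaxOn ⟨x, hVS hx, hcx⟩
    ((continuousOn_pogorelovWeight hS hu₂).mono (Set.sep_subset _ _))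
  have hy : (inner ℝ e y - c) * ‖iteratedFDerivWithin ℝ 2 u S y‖
      ≤ 1 + d ^ 2 * B + 2 * M + M * A * d + d * H := by
    by_cases hyV : y ∈ V
    · rcases hcy.eq_or_lt with hcy | hcy
      · rw [← hcy, sub_self, zero_mul]
        positivity
      · rw [iteratedFDerivWithin_of_mem_nhds (hSV y hyV), norm_iteratedFDeriv_two]
        refine (mul_norm_hess_le_of_isLocalMax hu hyV he (sub_pos.2 hcy) (hd y hyS) ?_ (hA y hyV)
          (hB y hyV) (isLocalMax_of_isMaxOn_pogorelovWeight hu.isOpen hVS hyV hcy hmax)).trans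
          (le_add_of_nonneg_right (by positivity))
        simpa only [fderivWithin_of_mem_nhds (hSV y hyV)] using hM y hyS
    · have hHy : (inner ℝ e y - c) * ‖iteratedFDerivWithin ℝ 2 u S y‖ ≤ d * H :=
        mul_le_mul (hd y hyS) (hH y ⟨hyS, hyV⟩) (norm_nonneg _) hd₀
      exact hHy.trans (le_add_of_nonneg_left (by positivity))
  calc (inner ℝ e x - c) * ‖iteratedFDeriv ℝ 2 u x‖
    _ ≤ pogorelovWeight e c u S x := by
      rw [← iteratedFDerivWithin_of_mem_nhds (hSV x hx)]
      exact le_mul_of_one_le_right (mul_nonneg (sub_nonneg.2 hcx) (norm_nonneg _))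
        (Real.one_le_exp (by positivity))
    _ ≤ pogorelovWeight e c u S y := hmax ⟨hVS hx, hcx⟩
    _ ≤ (1 + d ^ 2 * B + 2 * M + M * A * d + d * H) * Real.exp (M ^ 2 / 2) := by
      refine mul_le_mul hy ?_ (Real.exp_pos _).le (by positivity)
      gcongr
      exact hM y hyS
    _ = _ := mul_comm _ _

end HalfSpace

section Bound

/-- The right-hand side of the Hessian estimate as a function of `diam Ω`, `‖∇ log f‖`,
`‖∇² log f‖`, `‖∇u‖` and `‖∇²u‖_{L^∞(∂Ω)}`. The arguments enter through their positive parts, which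
makes it nondecreasing on all of `ℝ⁵`. -/
noncomputable def hessBound (t : ℝ × ℝ × ℝ × ℝ × ℝ) : ℝ :=
  Real.exp (max t.2.2.2.1 0 ^ 2 / 2) * (1 + max t.1 0 ^ 2 * max t.2.2.1 0 + 2 * max t.2.2.2.1 0
    + max t.2.2.2.1 0 * max t.2.1 0 * max t.1 0 + max t.1 0 * max t.2.2.2.2 0)

theorem hessBound_of_nonneg {d A B M H : ℝ} (hd : 0 ≤ d) (hA : 0 ≤ A) (hB : 0 ≤ B) (hM : 0 ≤ M)
    (hH : 0 ≤ H) : hessBound (d, A, B, M, H) =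
      Real.exp (M ^ 2 / 2) * (1 + d ^ 2 * B + 2 * M + M * A * d + d * H) := by
  simp only [hessBound, max_eq_left, hd, hA, hB, hM, hH]

theorem monotone_hessBound : Monotone hessBound := by
  rintro ⟨d, A, B, M, H⟩ ⟨d', A', B', M', H'⟩ ⟨hd, hA, hB, hM, hH⟩
  dsimp only at hd hA hB hM hH
  unfold hessBound
  gcongr

theorem hessBound_pos (t : ℝ × ℝ × ℝ × ℝ × ℝ) : 0 < hessBound t := by
  unfold hessBound
  positivity

end Bound

section Convexity

theorem fderiv_fderiv_nonneg_of_convexOn {E : Type*} [NormedAddCommGroup E] [NormedSpace ℝ E]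
    {s : Set E} {u : E → ℝ} {x : E} (hc : ConvexOn ℝ s u) (hs : s ∈ 𝓝 x) (hu : ContDiffAt ℝ 2 u x)
    (v : E) : 0 ≤ fderiv ℝ (fderiv ℝ u) x v v := by
  obtain ⟨r, hr, hball⟩ := Metric.eventually_nhds_iff_ball.1
    (((tendsto_line x v).eventually_mem hs).and
      (eventually_hasDerivAt_line (hu.of_le (by norm_num)) v))
  have hline : ConvexOn ℝ (Metric.ball (0 : ℝ) r) fun t ↦ u (x + t • v) := by
    have hcomp := hc.comp_affineMap (AffineMap.lineMap x (x + v))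
    simp only [Function.comp_def, AffineMap.lineMap_apply, vsub_eq_sub, vadd_eq_add,
      add_sub_cancel_left, add_comm _ x] at hcomp
    refine hcomp.subset (fun t ht ↦ ?_) (convex_ball 0 r)
    simpa [AffineMap.lineMap_apply, add_comm] using (hball t ht).1
  have hmono : MonotoneOn (fun t : ℝ ↦ ∂[v] u (x + t • v)) (Metric.ball 0 r) :=
    (hline.monotoneOn_deriv fun t ht ↦ (hball t ht).2.differentiableAt).congr
      fun t ht ↦ (hball t ht).2.deriv
  have hderiv := hasDerivAt_line (contDiffAt_dirDeriv (k := 1) hu (by norm_num) v) v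
  rw [← dirDeriv_dirDeriv_apply hu, ← hderiv.deriv,
    ← derivWithin_of_mem_nhds (Metric.ball_mem_nhds 0 hr)]
  exact hmono.derivWithin_nonneg

theorem exists_norm_eq_one_inner_add_infDist_le {E : Type*} [NormedAddCommGroup E]
    [InnerProductSpace ℝ E] [CompleteSpace E] {Γ : Set E} (hΓ : IsClosed Γ) (hne : Γ.Nonempty)
    (hc : Convex ℝ Γ) {x : E} (hx : x ∉ Γ) :
    ∃ e : E, ‖e‖ = 1 ∧ ∀ w ∈ Γ, inner ℝ e w + Metric.infDist x Γ ≤ inner ℝ e x := by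
  obtain ⟨p, hp, hpx⟩ := exists_norm_eq_iInf_of_complete_convex hne hΓ.isComplete hc x
  have hobtuse := (norm_eq_iInf_iff_real_inner_le_zero hc hp).1 hpx
  have hpos : 0 < ‖x - p‖ := norm_pos_iff.2 (sub_ne_zero.2 fun h ↦ hx (h ▸ hp))
  have hdist : Metric.infDist x Γ = ‖x - p‖ := by
    simp only [Metric.infDist_eq_iInf, dist_eq_norm, hpx]
  refine ⟨‖x - p‖⁻¹ • (x - p), by simp [norm_smul, hpos.ne'], fun w hw ↦ ?_⟩
  have hxp : inner ℝ (‖x - p‖⁻¹ • (x - p)) (x - p) = ‖x - p‖ := by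
    rw [real_inner_smul_left, real_inner_self_eq_norm_mul_norm, inv_mul_cancel_left₀ hpos.ne']
  have hwp : inner ℝ (‖x - p‖⁻¹ • (x - p)) (w - p) ≤ 0 := by
    rw [real_inner_smul_left]
    exact mul_nonpos_of_nonneg_of_nonpos (by positivity) (hobtuse w hw)
  rw [inner_sub_right] at hxp hwp
  linarith

end Convexity

section EssSup

variable {E F : Type*} [NormedAddCommGroup F] {s V : Set E} {g : E → F}

theorem eLpNorm_top_restrict_lt_top [MeasurableSpace E] {μ : Measure E} (hs : MeasurableSet s)
    (hg : ∃ C, ∀ x ∈ s, ‖g x‖ ≤ C) : eLpNorm g ⊤ (μ.restrict s) < ⊤ := by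
  obtain ⟨C, hC⟩ := hg
  rw [eLpNorm_exponent_top]
  exact eLpNormEssSup_lt_top_of_ae_bound (ae_restrict_of_forall_mem hs hC)

theorem norm_le_toReal_eLpNorm_top_of_continuousOn [TopologicalSpace E] [MeasurableSpace E]
    [OpensMeasurableSpace E] {μ : Measure E} [μ.IsOpenPosMeasure] (hV : IsOpen V) (hVs : V ⊆ s)
    (hg : ContinuousOn g V) (hfin : eLpNorm g ⊤ (μ.restrict s) ≠ ⊤) {x : E} (hx : x ∈ V) :
    ‖g x‖ ≤ (eLpNorm g ⊤ (μ.restrict s)).toReal := by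
  have hae : ∀ᵐ y ∂(μ.restrict s), ‖g y‖ ≤ (eLpNorm g ⊤ (μ.restrict s)).toReal := by
    rw [eLpNorm_exponent_top] at hfin ⊢
    filter_upwards [ae_le_eLpNormEssSup (f := g)] with y hy
    simpa using ENNReal.toReal_mono hfin hy
  have hdense : Dense {y | y ∈ V → ‖g y‖ ≤ (eLpNorm g ⊤ (μ.restrict s)).toReal} :=
    Measure.dense_of_ae
      ((ae_restrict_iff' hV.measurableSet).1 (ae_mono (Measure.restrict_mono_set μ hVs) hae))
  exact ContinuousWithinAt.closure_le (hdense.open_subset_closure_inter hV hx)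
    ((hg x hx).norm.mono Set.inter_subset_left) continuousWithinAt_const fun y hy ↦ hy.2 hy.1

end EssSup

section BoundedDerivatives

variable {E : Type*} [NormedAddCommGroup E] [NormedSpace ℝ E] {Ω D : Set E} {f u : E → ℝ}
  {K : ℝ≥0}

theorem exists_norm_fderiv_le_of_contDiffOn (hΩ : IsOpen Ω) (hΩD : Ω ⊆ D) (hD : IsCompact D)
    (hDu : UniqueDiffOn ℝ D) (hf : ContDiffOn ℝ 1 f D) : ∃ C, ∀ x ∈ Ω, ‖fderiv ℝ f x‖ ≤ C := by
  obtain ⟨C, hC⟩ := hD.exists_bound_of_continuousOn (hf.continuousOn_fderivWithin hDu le_rfl)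
  refine ⟨C, fun x hx ↦ ?_⟩
  rw [← fderivWithin_of_mem_nhds (mem_of_superset (hΩ.mem_nhds hx) hΩD)]
  exact hC x (hΩD hx)

theorem norm_fderiv_le_of_smul {F : Type*} [NormedAddCommGroup F] [NormedSpace ℝ F] {φ : E → ℝ}
    {L : E → F} {x : E} (hφ : DifferentiableAt ℝ φ x) (hx : 0 < φ x) :
    ‖fderiv ℝ L x‖ ≤
      (φ x)⁻¹ * (‖fderiv ℝ (fun y ↦ φ y • L y) x‖ + ‖fderiv ℝ φ x‖ * ‖L x‖) := by
  by_cases hL : DifferentiableAt ℝ L x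
  · rw [le_inv_mul_iff₀ hx]
    calc φ x * ‖fderiv ℝ L x‖
      _ = ‖fderiv ℝ (fun y ↦ φ y • L y) x - (fderiv ℝ φ x).smulRight (L x)‖ := by
        rw [fderiv_fun_smul hφ hL, add_sub_cancel_right, norm_smul, Real.norm_of_nonneg hx.le]
      _ ≤ ‖fderiv ℝ (fun y ↦ φ y • L y) x‖ + ‖fderiv ℝ φ x‖ * ‖L x‖ :=
        (norm_sub_le _ _).trans_eq (by rw [ContinuousLinearMap.norm_smulRight_apply])
  · rw [fderiv_zero_of_not_differentiableAt hL, norm_zero]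
    positivity

theorem norm_fderiv_fderiv_log_le {x : E} (hf : ContDiffAt ℝ 1 f x) (hx : 0 < f x)
    (hΩ : Ω ∈ 𝓝 x) (hK : LipschitzOnWith K (fderiv ℝ f) Ω) :
    ‖fderiv ℝ (fderiv ℝ fun y ↦ Real.log (f y)) x‖ ≤
      (f x)⁻¹ * (K + ‖fderiv ℝ f x‖ * ‖fderiv ℝ (fun y ↦ Real.log (f y)) x‖) := by
  have hlog : (fun y ↦ f y • fderiv ℝ (fun z ↦ Real.log (f z)) y) =ᶠ[𝓝 x] fderiv ℝ f := by
    filter_upwards [hf.eventually (by decide), hf.continuousAt.eventually_const_lt hx] with y hfy hy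
    rw [fderiv.log (hfy.differentiableAt one_ne_zero) hy.ne', smul_inv_smul₀ hy.ne']
  refine (norm_fderiv_le_of_smul (hf.differentiableAt one_ne_zero) hx).trans ?_
  rw [hlog.fderiv_eq]
  gcongr
  exact norm_fderiv_le_of_lipschitzOn ℝ hΩ hK

theorem exists_norm_fderiv_fderiv_log_le (hΩ : IsOpen Ω) (hΩD : Ω ⊆ D) (hD : IsCompact D)
    (hDu : UniqueDiffOn ℝ D) (hf : ContDiffOn ℝ 1 f D) (hf₀ : ∀ x ∈ D, 0 < f x)
    (hK : LipschitzOnWith K (fderivWithin ℝ f D) D) :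
    ∃ C, ∀ x ∈ Ω, ‖fderiv ℝ (fderiv ℝ fun y ↦ Real.log (f y)) x‖ ≤ C := by
  have hf₀' : ∀ x ∈ D, f x ≠ 0 := fun x hx ↦ (hf₀ x hx).ne'
  obtain ⟨C₀, hC₀⟩ := hD.exists_bound_of_continuousOn (hf.continuousOn.inv₀ hf₀')
  obtain ⟨C₁, hC₁⟩ := exists_norm_fderiv_le_of_contDiffOn hΩ hΩD hD hDu hf
  obtain ⟨C₂, hC₂⟩ := exists_norm_fderiv_le_of_contDiffOn hΩ hΩD hD hDu (hf.log hf₀')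
  have hDx : ∀ x ∈ Ω, D ∈ 𝓝 x := fun x hx ↦ mem_of_superset (hΩ.mem_nhds hx) hΩD
  have hK' : LipschitzOnWith K (fderiv ℝ f) Ω := fun x hx y hy ↦ by
    simpa only [fderivWithin_of_mem_nhds, hDx x hx, hDx y hy] using hK (hΩD hx) (hΩD hy)
  refine ⟨C₀ * (K + C₁ * C₂), fun x hx ↦ (norm_fderiv_fderiv_log_le (hf.contDiffAt (hDx x hx))
    (hf₀ x (hΩD hx)) (hΩ.mem_nhds hx) hK').trans ?_⟩
  have hC₁₀ := (norm_nonneg _).trans (hC₁ x hx)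
  have hC₀x := (le_abs_self _).trans (hC₀ x (hΩD hx))
  gcongr
  · exact (inv_nonneg.2 (hf₀ x (hΩD hx)).le).trans hC₀x
  · exact hC₀x
  · exact hC₁ x hx
  · exact hC₂ x hx

theorem exists_norm_fderiv_le_of_convexOn [FiniteDimensional ℝ E] {Γ : Set E} (hΩ : IsOpen Ω)
    (hD : IsCompact (closure Ω)) (hΓ : IsClosed Γ) (hΓΩ : Γ ⊆ Ω)
    (hS : UniqueDiffOn ℝ (closure Ω \ Γ)) (hc : ConvexOn ℝ (closure Ω) u)
    (hu : ContDiffOn ℝ 1 u (closure Ω \ Γ)) : ∃ C, ∀ x ∈ Ω, ‖fderiv ℝ u x‖ ≤ C := by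
  have hΓc : IsCompact Γ := hD.of_isClosed_subset hΓ (hΓΩ.trans subset_closure)
  obtain ⟨K, hK, hΓK, hKΩ⟩ := exists_compact_between hΓc hΩ hΓΩ
  obtain ⟨C₁, hC₁⟩ := (hc.locallyLipschitzOn_interior.mono
    (hKΩ.trans (interior_maximal subset_closure hΩ))).exists_lipschitzOnWith_of_compact hK
  obtain ⟨C₂, hC₂⟩ := (hD.diff isOpen_interior).exists_bound_of_continuousOn
    ((hu.continuousOn_fderivWithin hS le_rfl).mono (Set.sdiff_subset_sdiff_right hΓK))
  refine ⟨max C₁ C₂, fun x hx ↦ ?_⟩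
  by_cases hxK : x ∈ interior K
  · exact (norm_fderiv_le_of_lipschitzOn ℝ (mem_interior_iff_mem_nhds.1 hxK) hC₁).trans
      (le_max_left _ _)
  · have hmem : closure Ω \ Γ ∈ 𝓝 x := mem_of_superset
      ((hΩ.sdiff hΓ).mem_nhds ⟨hx, fun h ↦ hxK (hΓK h)⟩)
      (Set.sdiff_subset_sdiff_left subset_closure)
    rw [← fderivWithin_of_mem_nhds hmem]
    exact (hC₂ x ⟨subset_closure hx, hxK⟩).trans (le_max_right _ _)

end BoundedDerivatives

section SupNorms

variable {n : ℕ} {Ω Γ V : Set (EuclideanSpace ℝ (Fin n))} {f u : EuclideanSpace ℝ (Fin n) → ℝ}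
  {x : EuclideanSpace ℝ (Fin n)}

theorem norm_gradient (u : EuclideanSpace ℝ (Fin n) → ℝ) (x : EuclideanSpace ℝ (Fin n)) :
    ‖∇ u x‖ = ‖fderiv ℝ u x‖ := by
  simp [gradient]

theorem uniqueDiffOn_closure_sdiff (hΩ : IsOpen Ω) (hΩc : Convex ℝ Ω) (hne : Ω.Nonempty)
    (hΓ : IsClosed Γ) : UniqueDiffOn ℝ (closure Ω \ Γ) :=
  (uniqueDiffOn_convex hΩc.closure
    (hne.mono (interior_maximal subset_closure hΩ))).inter hΓ.isOpen_compl

theorem uniqueDiffOn_closure (hΩ : IsOpen Ω) (hΩc : Convex ℝ Ω) (hne : Ω.Nonempty) :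
    UniqueDiffOn ℝ (closure Ω) := by
  simpa using uniqueDiffOn_closure_sdiff hΩ hΩc hne isClosed_empty

theorem gradSupNorm_log_lt_top (hΩ : IsOpen Ω) (hb : Bornology.IsBounded Ω) (hΩc : Convex ℝ Ω)
    (hne : Ω.Nonempty) (hf : ContDiffOn ℝ 1 f (closure Ω)) (hf₀ : ∀ x ∈ closure Ω, 0 < f x) :
    gradSupNorm (fun x ↦ Real.log (f x)) Ω < ⊤ := by
  refine eLpNorm_top_restrict_lt_top hΩ.measurableSet ?_
  simp only [norm_gradient]
  exact exists_norm_fderiv_le_of_contDiffOn hΩ subset_closure hb.isCompact_closure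
    (uniqueDiffOn_closure hΩ hΩc hne) (hf.log fun x hx ↦ (hf₀ x hx).ne')

theorem hessSupNorm_log_lt_top (hΩ : IsOpen Ω) (hb : Bornology.IsBounded Ω) (hΩc : Convex ℝ Ω)
    (hne : Ω.Nonempty) (hf : IsC11On f (closure Ω)) (hf₀ : ∀ x ∈ closure Ω, 0 < f x) :
    hessSupNorm (fun x ↦ Real.log (f x)) Ω < ⊤ := by
  obtain ⟨hf₁, K, hK⟩ := hf
  refine eLpNorm_top_restrict_lt_top hΩ.measurableSet ?_
  simp only [norm_iteratedFDeriv_two]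
  exact exists_norm_fderiv_fderiv_log_le hΩ subset_closure hb.isCompact_closure
    (uniqueDiffOn_closure hΩ hΩc hne) hf₁ hf₀ hK

theorem gradSupNorm_lt_top_of_convexOn (hΩ : IsOpen Ω) (hb : Bornology.IsBounded Ω)
    (hΩc : Convex ℝ Ω) (hne : Ω.Nonempty) (hΓ : IsClosed Γ) (hΓΩ : Γ ⊆ Ω)
    (hc : ConvexOn ℝ (closure Ω) u) (hu : ContDiffOn ℝ 1 u (closure Ω \ Γ)) :
    gradSupNorm u Ω < ⊤ := by
  refine eLpNorm_top_restrict_lt_top hΩ.measurableSet ?_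
  simp only [norm_gradient]
  exact exists_norm_fderiv_le_of_convexOn hΩ hb.isCompact_closure hΓ hΓΩ
    (uniqueDiffOn_closure_sdiff hΩ hΩc hne hΓ) hc hu

theorem frontier_subset_closure_sdiff (hΩ : IsOpen Ω) (hΓΩ : Γ ⊆ Ω) :
    frontier Ω ⊆ closure Ω \ Γ := by
  rw [hΩ.frontier_eq]
  exact Set.sdiff_subset_sdiff_right hΓΩ

theorem iteratedFDerivWithin_closure_of_mem_frontier (hΩ : IsOpen Ω) (hΓ : IsClosed Γ)
    (hΓΩ : Γ ⊆ Ω) (hx : x ∈ frontier Ω) :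
    iteratedFDerivWithin ℝ 2 u (closure Ω) x = iteratedFDerivWithin ℝ 2 u (closure Ω \ Γ) x :=
  (iteratedFDerivWithin_inter_open hΓ.isOpen_compl
    (frontier_subset_closure_sdiff hΩ hΓΩ hx).2).symm

theorem hessBoundarySupNorm_lt_top (hΩ : IsOpen Ω) (hb : Bornology.IsBounded Ω)
    (hΩc : Convex ℝ Ω) (hne : Ω.Nonempty) (hΓ : IsClosed Γ) (hΓΩ : Γ ⊆ Ω)
    (hu : ContDiffOn ℝ 2 u (closure Ω \ Γ)) : hessBoundarySupNorm u Ω < ⊤ := by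
  have hcompact : IsCompact (frontier Ω) :=
    hb.isCompact_closure.of_isClosed_subset isClosed_frontier frontier_subset_closure
  obtain ⟨C, hC⟩ := hcompact.exists_bound_of_continuousOn
    ((hu.continuousOn_iteratedFDerivWithin le_rfl
      (uniqueDiffOn_closure_sdiff hΩ hΩc hne hΓ)).mono (frontier_subset_closure_sdiff hΩ hΓΩ))
  refine (iSup₂_le (a := ENNReal.ofReal C) fun x hx ↦ ?_).trans_lt ENNReal.ofReal_lt_top
  rw [iteratedFDerivWithin_closure_of_mem_frontier hΩ hΓ hΓΩ hx, ← ofReal_norm]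
  exact ENNReal.ofReal_le_ofReal (hC x hx)

theorem norm_fderiv_le_gradSupNorm (hV : IsOpen V) (hVΩ : V ⊆ Ω) (hu : ContDiffOn ℝ 1 u V)
    (hfin : gradSupNorm u Ω < ⊤) (hx : x ∈ V) : ‖fderiv ℝ u x‖ ≤ (gradSupNorm u Ω).toReal := by
  rw [← norm_gradient]
  exact norm_le_toReal_eLpNorm_top_of_continuousOn hV hVΩ
    ((InnerProductSpace.toDual ℝ (EuclideanSpace ℝ (Fin n))).symm.continuous.comp_continuousOn
      (hu.continuousOn_fderiv_of_isOpen hV le_rfl)) hfin.ne hx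

theorem norm_fderiv_fderiv_le_hessSupNorm (hV : IsOpen V) (hVΩ : V ⊆ Ω) (hu : ContDiffOn ℝ 2 u V)
    (hfin : hessSupNorm u Ω < ⊤) (hx : x ∈ V) :
    ‖fderiv ℝ (fderiv ℝ u) x‖ ≤ (hessSupNorm u Ω).toReal := by
  rw [← norm_iteratedFDeriv_two]
  refine norm_le_toReal_eLpNorm_top_of_continuousOn hV hVΩ ?_ hfin.ne hx
  exact (hu.continuousOn_iteratedFDerivWithin le_rfl hV.uniqueDiffOn).congr
    fun y hy ↦ (iteratedFDerivWithin_of_isOpen 2 hV hy).symm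

theorem norm_iteratedFDerivWithin_le_hessBoundarySupNorm (hΩ : IsOpen Ω) (hΓ : IsClosed Γ)
    (hΓΩ : Γ ⊆ Ω) (hfin : hessBoundarySupNorm u Ω < ⊤) (hx : x ∈ frontier Ω) :
    ‖iteratedFDerivWithin ℝ 2 u (closure Ω \ Γ) x‖ ≤ (hessBoundarySupNorm u Ω).toReal := by
  rw [← iteratedFDerivWithin_closure_of_mem_frontier hΩ hΓ hΓΩ hx]
  have hle : ‖iteratedFDerivWithin ℝ 2 u (closure Ω) x‖ₑ ≤ hessBoundarySupNorm u Ω :=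
    le_iSup₂ (f := fun x (_ : x ∈ frontier Ω) ↦ ‖iteratedFDerivWithin ℝ 2 u (closure Ω) x‖ₑ) x hx
  simpa using ENNReal.toReal_mono hfin.ne hle

end SupNorms

section SingularSolution

theorem isCompact_closure_sdiff_inter_halfSpace {E : Type*} [NormedAddCommGroup E]
    [InnerProductSpace ℝ E] [ProperSpace E] {Ω Γ : Set E} {e : E} {c : ℝ}
    (hb : Bornology.IsBounded Ω) (hsep : ∀ w ∈ Γ, inner ℝ e w < c) :
    IsCompact {y ∈ closure Ω \ Γ | c ≤ inner ℝ e y} := by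
  have hclosed : IsClosed {y : E | c ≤ inner ℝ e y} := isClosed_le continuous_const (by fun_prop)
  have heq : {y ∈ closure Ω \ Γ | c ≤ inner ℝ e y} = closure Ω ∩ {y | c ≤ inner ℝ e y} := by
    ext y
    exact ⟨fun hy ↦ ⟨hy.1.1, hy.2⟩, fun hy ↦ ⟨⟨hy.1, fun hyΓ ↦ (hsep y hyΓ).not_ge hy.2⟩, hy.2⟩⟩
  exact heq ▸ hb.isCompact_closure.inter_right hclosed

theorem inner_sub_le_diam {E : Type*} [NormedAddCommGroup E] [InnerProductSpace ℝ E] {Ω : Set E}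
    {e p y : E} {c : ℝ} (hb : Bornology.IsBounded Ω) (he : ‖e‖ = 1) (hp : p ∈ closure Ω)
    (hpc : inner ℝ e p ≤ c) (hy : y ∈ closure Ω) : inner ℝ e y - c ≤ Metric.diam Ω :=
  calc inner ℝ e y - c
    _ ≤ inner ℝ e (y - p) := by rw [inner_sub_right]; gcongr
    _ ≤ ‖e‖ * ‖y - p‖ := real_inner_le_norm _ _
    _ = dist y p := by rw [he, one_mul, dist_eq_norm]
    _ ≤ Metric.diam (closure Ω) := Metric.dist_le_diam_of_mem hb.closure hy hp
    _ = Metric.diam Ω := Metric.diam_closure Ω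

variable {n : ℕ} {Ω Γ : Set (EuclideanSpace ℝ (Fin n))} {f u : EuclideanSpace ℝ (Fin n) → ℝ}
  {e x : EuclideanSpace ℝ (Fin n)} {c : ℝ}

/-- `u` is a convex solution of `det ∇²u = f` on a bounded convex domain `Ω`, with all singularities
on a closed convex set `Γ` inside `Ω`, and `f` is positive of class `C^{1,1}`. -/
structure IsSingularSolution (Ω Γ : Set (EuclideanSpace ℝ (Fin n)))
    (f u : EuclideanSpace ℝ (Fin n) → ℝ) : Prop where
  isOpen : IsOpen Ω
  isBounded : Bornology.IsBounded Ω
  convex : Convex ℝ Ω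
  isClosed_singularSet : IsClosed Γ
  nonempty_singularSet : Γ.Nonempty
  convex_singularSet : Convex ℝ Γ
  singularSet_subset : Γ ⊆ Ω
  isC11On : IsC11On f (closure Ω)
  pos : ∀ x ∈ closure Ω, 0 < f x
  convexOn : ConvexOn ℝ (closure Ω) u
  contDiffOn_closure : ContDiffOn ℝ 2 u (closure Ω \ Γ)
  contDiffOn : ContDiffOn ℝ 4 u (Ω \ Γ)
  det_eq : ∀ x ∈ Ω \ Γ, (hessianMatrix u x).det = f x

namespace IsSingularSolution

theorem nonempty (h : IsSingularSolution Ω Γ f u) : Ω.Nonempty :=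
  h.nonempty_singularSet.mono h.singularSet_subset

theorem isOpen_sdiff (h : IsSingularSolution Ω Γ f u) : IsOpen (Ω \ Γ) :=
  h.isOpen.sdiff h.isClosed_singularSet

theorem uniqueDiffOn (h : IsSingularSolution Ω Γ f u) : UniqueDiffOn ℝ (closure Ω \ Γ) :=
  uniqueDiffOn_closure_sdiff h.isOpen h.convex h.nonempty h.isClosed_singularSet

theorem isMongeAmpereSolution (h : IsSingularSolution Ω Γ f u) :
    IsMongeAmpereSolution u (fun x ↦ Real.log (f x)) (Ω \ Γ) where
  isOpen := h.isOpen_sdiff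
  contDiffOn := h.contDiffOn
  hess_nonneg y hy := fderiv_fderiv_nonneg_of_convexOn h.convexOn
    (mem_of_superset (h.isOpen.mem_nhds hy.1) subset_closure)
    ((h.contDiffOn.contDiffAt (h.isOpen_sdiff.mem_nhds hy)).of_le (by norm_num))
  det_eq_exp y hy := by
    rw [← det_hessianMatrix, h.det_eq y hy, Real.exp_log (h.pos y (subset_closure hy.1))]

theorem gradSupNorm_log_lt_top (h : IsSingularSolution Ω Γ f u) :
    gradSupNorm (fun x ↦ Real.log (f x)) Ω < ⊤ :=
  _root_.gradSupNorm_log_lt_top h.isOpen h.isBounded h.convex h.nonempty h.isC11On.1 h.pos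

theorem hessSupNorm_log_lt_top (h : IsSingularSolution Ω Γ f u) :
    hessSupNorm (fun x ↦ Real.log (f x)) Ω < ⊤ :=
  _root_.hessSupNorm_log_lt_top h.isOpen h.isBounded h.convex h.nonempty h.isC11On h.pos

theorem gradSupNorm_lt_top (h : IsSingularSolution Ω Γ f u) : gradSupNorm u Ω < ⊤ :=
  gradSupNorm_lt_top_of_convexOn h.isOpen h.isBounded h.convex h.nonempty h.isClosed_singularSet
    h.singularSet_subset h.convexOn (h.contDiffOn_closure.of_le (by norm_num))

theorem hessBoundarySupNorm_lt_top (h : IsSingularSolution Ω Γ f u) :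
    hessBoundarySupNorm u Ω < ⊤ :=
  _root_.hessBoundarySupNorm_lt_top h.isOpen h.isBounded h.convex h.nonempty
    h.isClosed_singularSet h.singularSet_subset h.contDiffOn_closure

theorem norm_fderivWithin_le (h : IsSingularSolution Ω Γ f u) (hx : x ∈ closure Ω \ Γ) :
    ‖fderivWithin ℝ u (closure Ω \ Γ) x‖ ≤ (gradSupNorm u Ω).toReal := by
  have hsub : Ω \ Γ ⊆ closure Ω \ Γ := Set.sdiff_subset_sdiff_left subset_closure
  have hcont := (h.contDiffOn_closure.continuousOn_fderivWithin h.uniqueDiffOn (by norm_num)).norm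
  refine ContinuousWithinAt.closure_le (h.isClosed_singularSet.isOpen_compl.closure_inter hx)
    ((hcont x hx).mono hsub) continuousWithinAt_const fun y hy ↦ ?_
  rw [fderivWithin_of_mem_nhds (mem_of_superset (h.isOpen_sdiff.mem_nhds hy) hsub)]
  exact norm_fderiv_le_gradSupNorm h.isOpen_sdiff Set.sdiff_subset
    (h.contDiffOn.of_le (by norm_num)) h.gradSupNorm_lt_top hy

theorem mul_norm_hess_le_hessBound (h : IsSingularSolution Ω Γ f u) (he : ‖e‖ = 1)
    (hsep : ∀ w ∈ Γ, inner ℝ e w < c) (hx : x ∈ Ω \ Γ) (hcx : c ≤ inner ℝ e x) :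
    (inner ℝ e x - c) * ‖iteratedFDeriv ℝ 2 u x‖ ≤
      hessBound (Metric.diam Ω, (gradSupNorm (fun x ↦ Real.log (f x)) Ω).toReal,
        (hessSupNorm (fun x ↦ Real.log (f x)) Ω).toReal, (gradSupNorm u Ω).toReal,
        (hessBoundarySupNorm u Ω).toReal) := by
  have hsol := h.isMongeAmpereSolution
  have hlog : ContDiffOn ℝ 2 (fun x ↦ Real.log (f x)) (Ω \ Γ) :=
    fun y hy ↦ (hsol.contDiffAt_right hy).contDiffWithinAt
  obtain ⟨p, hp⟩ := h.nonempty_singularSet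
  rw [hessBound_of_nonneg Metric.diam_nonneg ENNReal.toReal_nonneg ENNReal.toReal_nonneg
    ENNReal.toReal_nonneg ENNReal.toReal_nonneg]
  refine mul_norm_hess_le_of_halfSpace h.uniqueDiffOn h.contDiffOn_closure hsol
    (Set.sdiff_subset_sdiff_left subset_closure) he
    (isCompact_closure_sdiff_inter_halfSpace h.isBounded hsep)
    (fun y ↦ norm_fderiv_le_gradSupNorm hsol.isOpen Set.sdiff_subset (hlog.of_le (by norm_num))
      h.gradSupNorm_log_lt_top)
    (fun y ↦ norm_fderiv_fderiv_le_hessSupNorm hsol.isOpen Set.sdiff_subset hlog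
      h.hessSupNorm_log_lt_top)
    (fun y ↦ h.norm_fderivWithin_le) (fun y hy ↦ ?_) ENNReal.toReal_nonneg
    (fun y hy ↦ inner_sub_le_diam h.isBounded he (subset_closure (h.singularSet_subset hp))
      (hsep p hp).le hy.1) hx hcx
  refine norm_iteratedFDerivWithin_le_hessBoundarySupNorm h.isOpen h.isClosed_singularSet
    h.singularSet_subset h.hessBoundarySupNorm_lt_top ?_
  rw [h.isOpen.frontier_eq]
  exact ⟨hy.1.1, fun hyΩ ↦ hy.2 ⟨hyΩ, hy.1.2⟩⟩

theorem norm_hess_le_hessBound_div (h : IsSingularSolution Ω Γ f u) (hx : x ∈ Ω \ Γ) :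
    ‖iteratedFDeriv ℝ 2 u x‖ ≤
      hessBound (Metric.diam Ω, (gradSupNorm (fun x ↦ Real.log (f x)) Ω).toReal,
        (hessSupNorm (fun x ↦ Real.log (f x)) Ω).toReal, (gradSupNorm u Ω).toReal,
        (hessBoundarySupNorm u Ω).toReal) / Metric.infDist x Γ := by
  have hdist : 0 < Metric.infDist x Γ :=
    (h.isClosed_singularSet.notMem_iff_infDist_pos h.nonempty_singularSet).1 hx.2
  obtain ⟨e, he, hsep⟩ := exists_norm_eq_one_inner_add_infDist_le h.isClosed_singularSet
    h.nonempty_singularSet h.convex_singularSet hx.2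
  rw [le_div_iff₀' hdist]
  -- `∇²u` is not controlled near `Γ`, so the half-space stays at a positive distance from it.
  refine mul_le_of_forall_lt_of_nonneg hdist.le (hessBound_pos _).le fun s hs₀ hs N _ hN ↦ ?_
  have hcut := h.mul_norm_hess_le_hessBound (c := inner ℝ e x - s) he
    (fun w hw ↦ by linarith [hsep w hw]) hx (by linarith)
  rw [sub_sub_cancel] at hcut
  exact (mul_le_mul_of_nonneg_left hN.le hs₀).trans hcut

end IsSingularSolution

end SingularSolution

theorem isClosed_nonempty_convex_of_singleton_or_segment {E : Type*} [NormedAddCommGroup E]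
    [NormedSpace ℝ E] {Γ : Set E} (hΓ : (∃ a, Γ = {a}) ∨ ∃ a b, a ≠ b ∧ Γ = segment ℝ a b) :
    IsClosed Γ ∧ Γ.Nonempty ∧ Convex ℝ Γ := by
  rcases hΓ with ⟨a, rfl⟩ | ⟨a, b, -, rfl⟩
  · exact ⟨isClosed_singleton, Set.singleton_nonempty a, convex_singleton a⟩
  · refine ⟨?_, ⟨a, left_mem_segment ℝ a b⟩, convex_segment a b⟩
    rw [← convexHull_pair]
    exact (Set.toFinite {a, b}).isClosed_convexHull ℝ

theorem theorem4p2_general :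
    ∃ C : ℝ × ℝ × ℝ × ℝ × ℝ → ℝ, Monotone C ∧ (∀ t, 0 < C t) ∧
      ∀ (n : ℕ) (Ω Γ : Set (EuclideanSpace ℝ (Fin n))) (f u : EuclideanSpace ℝ (Fin n) → ℝ),
        IsOpen Ω → Bornology.IsBounded Ω → Convex ℝ Ω →
        IsClosed Γ → Γ.Nonempty → Convex ℝ Γ → Γ ⊆ Ω →
        IsC11On f (closure Ω) → (∀ x ∈ closure Ω, 0 < f x) →
        ConvexOn ℝ (closure Ω) u →
        ContDiffOn ℝ 2 u (closure Ω \ Γ) → ContDiffOn ℝ 4 u (Ω \ Γ) →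
        (∀ x ∈ Ω \ Γ, (hessianMatrix u x).det = f x) →
        gradSupNorm (fun x => Real.log (f x)) Ω < ⊤ ∧
        hessSupNorm (fun x => Real.log (f x)) Ω < ⊤ ∧
        gradSupNorm u Ω < ⊤ ∧
        hessBoundarySupNorm u Ω < ⊤ ∧
        ∀ x ∈ Ω \ Γ, ‖iteratedFDeriv ℝ 2 u x‖ ≤
          C (Metric.diam Ω,
            (gradSupNorm (fun x => Real.log (f x)) Ω).toReal,
            (hessSupNorm (fun x => Real.log (f x)) Ω).toReal,
            (gradSupNorm u Ω).toReal,
            (hessBoundarySupNorm u Ω).toReal) / Metric.infDist x Γ := by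
  refine ⟨hessBound, monotone_hessBound, hessBound_pos, ?_⟩
  intro n Ω Γ f u hΩ hb hΩc hΓ hΓne hΓc hΓΩ hf hf₀ hc hu₂ hu₄ hdet
  have h : IsSingularSolution Ω Γ f u :=
    ⟨hΩ, hb, hΩc, hΓ, hΓne, hΓc, hΓΩ, hf, hf₀, hc, hu₂, hu₄, hdet⟩
  exact ⟨h.gradSupNorm_log_lt_top, h.hessSupNorm_log_lt_top, h.gradSupNorm_lt_top,
    h.hessBoundarySupNorm_lt_top, fun x ↦ h.norm_hess_le_hessBound_div⟩

theorem theorem4p2 (n : ℕ) (hn : 2 ≤ n) :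
    ∃ C : ℝ × ℝ × ℝ × ℝ × ℝ → ℝ, Monotone C ∧ (∀ t, 0 < C t) ∧
      ∀ (Ω Γ : Set (EuclideanSpace ℝ (Fin n))) (f u : EuclideanSpace ℝ (Fin n) → ℝ),
        IsOpen Ω → Bornology.IsBounded Ω → Convex ℝ Ω → HasSmoothBoundary Ω →
        ((∃ a, Γ = {a}) ∨ ∃ a b, a ≠ b ∧ Γ = segment ℝ a b) → Γ ⊆ Ω →
        IsC11On f (closure Ω) → (∀ x ∈ closure Ω, 0 < f x) →
        ConvexOn ℝ (closure Ω) u →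
        ContDiffOn ℝ 2 u (closure Ω \ Γ) → ContDiffOn ℝ 4 u (Ω \ Γ) →
        (∀ x ∈ Ω \ Γ, (hessianMatrix u x).det = f x) →
        gradSupNorm (fun x => Real.log (f x)) Ω < ⊤ ∧
        hessSupNorm (fun x => Real.log (f x)) Ω < ⊤ ∧
        gradSupNorm u Ω < ⊤ ∧
        hessBoundarySupNorm u Ω < ⊤ ∧
        ∀ x ∈ Ω \ Γ, ‖iteratedFDeriv ℝ 2 u x‖ ≤
          C (Metric.diam Ω,
            (gradSupNorm (fun x => Real.log (f x)) Ω).toReal,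
            (hessSupNorm (fun x => Real.log (f x)) Ω).toReal,
            (gradSupNorm u Ω).toReal,
            (hessBoundarySupNorm u Ω).toReal) / Metric.infDist x Γ := by
  obtain ⟨C, hmono, hpos, hC⟩ := theorem4p2_general
  refine ⟨C, hmono, hpos, fun Ω Γ f u hΩ hb hΩc _ hΓ ↦ ?_⟩
  obtain ⟨hΓclosed, hΓne, hΓc⟩ := isClosed_nonempty_convex_of_singleton_or_segment hΓ
  exact hC n Ω Γ f u hΩ hb hΩc hΓclosed hΓne hΓc
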